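/- Let $k$ be an algebraically closed field, $Q$ a finite connected quiver without oriented cycles, and $\sigma$ an automorphism of $Q$ of order $n$, with $\operatorname{char} k\nmid n$. All modules are finitely generated left modules. Extend $\sigma$ linearly to the path algebra $kQ$ and let $kQ\#k\langle\sigma\rangle$ be the skew group algebra, with multiplication $(p\#g)(q\#h)=p\,g(q)\#gh$. For $g\in\langle\sigma\rangle$ and a $kQ$-module $X$ let ${}^{g}X$ be the same vector space with the action $p\cdot x=g^{-1}(p)x$. Call $X$ *$\langle\sigma\rangle$-equivalent* if ${}^{\sigma}X\cong X$ as $kQ$-modules, and *indecomposable $\langle\sigma\rangle$-equivalent* if it is nonzero and $\langle\sigma\rangle$-equivalent and is not a direct sum of two nonzero $\langle\sigma\rangle$-equivalent $kQ$-modules. The indecomposable $\langle\sigma\rangle$-equivalent $kQ$-modules are exactly the modules isomorphic to $$Y\oplus{}^{\sigma}Y\oplus\cdots\oplus{}^{\sigma^{m-1}}Y$$ with $Y$ an indecomposable $kQ$-module and $m\ge 1$ minimal such that ${}^{\sigma^m}Y\cong Y$, and: (1) Every indecomposable $kQ\#k\langle\sigma\rangle$-module is, as a $kQ$-module, an indecomposable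 $\langle\sigma\rangle$-equivalent $kQ$-module, and hence of the form above. (2) Conversely, let $X$ be an indecomposable $\langle\sigma\rangle$-equivalent $kQ$-module. Then there is an isomorphism of $kQ$-modules $\phi:{}^{\sigma}X\to X$ such that $\phi^n=\mathrm{id}$ as a map on the underlying space of $X$; and for every such $\phi$, the canonical induced $kQ\#k\langle\sigma\rangle$-module on $X$, in which $p\#\sigma^i$ acts by $x\mapsto p\,\phi^i(x)$, is indecomposable. -/

import Mathlib

open CategoryTheory

noncomputable section

universe u v w

/-! ### The path algebra of a quiver -/

/-- The type of all paths of the quiver `V`: a start vertex, an end vertex, and a path. -/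
abbrev QuiverPath (V : Type u) [Quiver.{v} V] : Type (max u v) :=
  Σ a b : V, Quiver.Path a b

/-- A quiver has no oriented cycles: every path from a vertex to itself is trivial. -/
def NoOrientedCycles (V : Type u) [Quiver.{v} V] : Prop :=
  ∀ (a : V) (p : Quiver.Path a a), p.length = 0

/-- The path algebra `kQ`: the free `k`-module on the set of all paths. -/
def PathAlgebra (k : Type w) [CommRing k] (V : Type u) [Quiver.{v} V] : Type (max u v w) :=
  QuiverPath V →₀ k

namespace PathAlgebra

variable {k : Type w} [CommRing k] {V : Type u} [Quiver.{v} V]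

instance : AddCommGroup (PathAlgebra k V) := inferInstanceAs (AddCommGroup (QuiverPath V →₀ k))

instance : Module k (PathAlgebra k V) := inferInstanceAs (Module k (QuiverPath V →₀ k))

/-- The basis element of `kQ` given by a path. -/
def ofPath (p : QuiverPath V) : PathAlgebra k V := Finsupp.single p 1

@[elab_as_elim]
theorem induction {P : PathAlgebra k V → Prop} (x : PathAlgebra k V) (h0 : P 0)
    (hadd : ∀ x y, P x → P y → P (x + y)) (hsmul : ∀ (c : k) (p : QuiverPath V), P (c • ofPath p)) :
    P x := by
  refine Finsupp.induction_linear (motive := P) x h0 hadd fun p c => ?_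
  have h : (Finsupp.single p c : QuiverPath V →₀ k) = c • Finsupp.single p 1 := by simp
  rw [h]
  exact hsmul c p

open Classical in
/-- The product `p q` of two paths, "first `q`, then `p`": it is the concatenated path if `q` ends
where `p` starts, and `0` otherwise. -/
def pathMul (p q : QuiverPath V) : PathAlgebra k V :=
  if h : q.2.1 = p.1 then ofPath ⟨q.1, p.2.1, (q.2.2.cast rfl h).comp p.2.2⟩ else 0

theorem pathMul_comp {a b c : V} (p : Quiver.Path b c) (q : Quiver.Path a b) :
    (pathMul ⟨b, c, p⟩ ⟨a, b, q⟩ : PathAlgebra k V) = ofPath ⟨a, c, q.comp p⟩ := by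
  simp [pathMul]

theorem pathMul_of_ne {p q : QuiverPath V} (h : q.2.1 ≠ p.1) :
    (pathMul p q : PathAlgebra k V) = 0 := by
  simp [pathMul, h]

/-- The `k`-bilinear extension of `pathMul` to `kQ`. -/
def mulBilin : PathAlgebra k V →ₗ[k] PathAlgebra k V →ₗ[k] PathAlgebra k V :=
  Finsupp.linearCombination k fun p : QuiverPath V =>
    (Finsupp.linearCombination k fun q : QuiverPath V => (pathMul p q : PathAlgebra k V) :
      (QuiverPath V →₀ k) →ₗ[k] PathAlgebra k V)

instance : Mul (PathAlgebra k V) := ⟨fun x y => mulBilin x y⟩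

theorem mul_def (x y : PathAlgebra k V) : x * y = mulBilin x y := rfl

theorem ofPath_mul_ofPath (p q : QuiverPath V) :
    (ofPath p * ofPath q : PathAlgebra k V) = pathMul p q := by
  have h : ∀ x : QuiverPath V →₀ k, mulBilin (ofPath p : PathAlgebra k V) x =
      Finsupp.linearCombination k (fun q : QuiverPath V => (pathMul p q : PathAlgebra k V)) x := by
    intro x
    unfold mulBilin ofPath
    erw [Finsupp.linearCombination_single, one_smul]
    rfl
  refine (h (Finsupp.single q 1)).trans ?_
  rw [Finsupp.linearCombination_single, one_smul]

theorem smul_mul' (c : k) (x y : PathAlgebra k V) : (c • x) * y = c • (x * y) := by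
  simp [mul_def]

theorem mul_smul' (c : k) (x y : PathAlgebra k V) : x * (c • y) = c • (x * y) := by
  simp [mul_def]

instance : NonUnitalNonAssocRing (PathAlgebra k V) where
  left_distrib x y z := by simp [mul_def]
  right_distrib x y z := by simp [mul_def]
  zero_mul x := by simp [mul_def]
  mul_zero x := by simp [mul_def]

theorem mul_assoc_ofPath (p q r : QuiverPath V) :
    (ofPath p * ofPath q * ofPath r : PathAlgebra k V) = ofPath p * (ofPath q * ofPath r) := by
  obtain ⟨p₁, p₂, p⟩ := p
  obtain ⟨q₁, q₂, q⟩ := q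
  obtain ⟨r₁, r₂, r⟩ := r
  rw [ofPath_mul_ofPath, ofPath_mul_ofPath]
  by_cases h : q₂ = p₁
  · subst h
    rw [pathMul_comp, ofPath_mul_ofPath]
    by_cases h' : r₂ = q₁
    · subst h'
      rw [pathMul_comp, pathMul_comp, ofPath_mul_ofPath, pathMul_comp, Quiver.Path.comp_assoc]
    · rw [pathMul_of_ne (by exact h'), pathMul_of_ne (by exact h'), mul_zero]
  · rw [pathMul_of_ne (by exact h), zero_mul]
    by_cases h' : r₂ = q₁
    · subst h'
      rw [pathMul_comp, ofPath_mul_ofPath, pathMul_of_ne (by exact h)]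
    · rw [pathMul_of_ne (by exact h'), mul_zero]

variable [Fintype V]

/-- The unit of `kQ` is the sum of the trivial paths `e_a`, `a` a vertex. -/
instance : One (PathAlgebra k V) := ⟨∑ a : V, ofPath ⟨a, a, Quiver.Path.nil⟩⟩

theorem one_def : (1 : PathAlgebra k V) = ∑ a : V, ofPath ⟨a, a, Quiver.Path.nil⟩ := rfl

theorem one_mul_ofPath (p : QuiverPath V) : (1 * ofPath p : PathAlgebra k V) = ofPath p := by
  obtain ⟨a, b, p⟩ := p
  rw [one_def, Finset.sum_mul, Finset.sum_eq_single b]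
  · rw [ofPath_mul_ofPath, pathMul_comp, Quiver.Path.comp_nil]
  · intro c _ hc
    rw [ofPath_mul_ofPath, pathMul_of_ne (by exact hc.symm)]
  · simp

theorem ofPath_mul_one (p : QuiverPath V) : (ofPath p * 1 : PathAlgebra k V) = ofPath p := by
  obtain ⟨a, b, p⟩ := p
  rw [one_def, Finset.mul_sum, Finset.sum_eq_single a]
  · rw [ofPath_mul_ofPath, pathMul_comp, Quiver.Path.nil_comp]
  · intro c _ hc
    rw [ofPath_mul_ofPath, pathMul_of_ne (by exact hc)]
  · simp

instance : Ring (PathAlgebra k V) where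
  mul_assoc x y z := by
    refine induction x (by simp) (fun x x' h h' => by simp [add_mul, h, h']) fun c p => ?_
    refine induction y (by simp) (fun y y' h h' => by simp [add_mul, mul_add, h, h']) fun d q => ?_
    refine induction z (by simp) (fun z z' h h' => by simp [mul_add, h, h']) fun e r => ?_
    simp only [smul_mul', mul_smul', mul_assoc_ofPath]
  one_mul x := by
    refine induction x (by simp) (fun x x' h h' => by simp [mul_add, h, h']) fun c p => ?_
    rw [mul_smul', one_mul_ofPath]
  mul_one x := by
    refine induction x (by simp) (fun x x' h h' => by simp [add_mul, h, h']) fun c p => ?_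
    rw [smul_mul', ofPath_mul_one]
  __ := (inferInstance : NonUnitalNonAssocRing (PathAlgebra k V))

instance : Algebra k (PathAlgebra k V) := Algebra.ofModule smul_mul' fun c x y => mul_smul' c x y

end PathAlgebra

/-! ### The action of quiver automorphisms on the path algebra -/

/-- The group of automorphisms of the quiver `V`, i.e. of `V` as an object of the category of
quivers; the product `σ * τ` is "first `τ`, then `σ`". -/
abbrev QuiverAut (V : Type u) [Quiver.{v} V] : Type (max u v) := Aut (Quiv.of V)

namespace QuiverAut

variable {V : Type u} [Quiver.{v} V]

/-- The morphism of quivers underlying an automorphism. -/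
def toPrefunctor (σ : QuiverAut V) : V ⥤q V := Prefunctor.ofQuivHom σ.hom

theorem toPrefunctor_one : toPrefunctor (1 : QuiverAut V) = 𝟭q V := rfl

theorem toPrefunctor_mul (σ τ : QuiverAut V) :
    toPrefunctor (σ * τ) = toPrefunctor τ ⋙q toPrefunctor σ := rfl

/-- Automorphisms act on paths, arrow by arrow. -/
instance : MulAction (QuiverAut V) (QuiverPath V) where
  smul σ p := ⟨σ.toPrefunctor.obj p.1, σ.toPrefunctor.obj p.2.1, σ.toPrefunctor.mapPath p.2.2⟩
  one_smul p := by
    obtain ⟨a, b, p⟩ := p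
    change (⟨_, _, (toPrefunctor 1).mapPath p⟩ : QuiverPath V) = _
    rw [toPrefunctor_one, Prefunctor.mapPath_id]
    rfl
  mul_smul σ τ p := by
    obtain ⟨a, b, p⟩ := p
    change (⟨_, _, (toPrefunctor (σ * τ)).mapPath p⟩ : QuiverPath V) =
      ⟨_, _, σ.toPrefunctor.mapPath (τ.toPrefunctor.mapPath p)⟩
    rw [toPrefunctor_mul, Prefunctor.mapPath_comp_apply]
    rfl

theorem smul_mk (σ : QuiverAut V) {a b : V} (p : Quiver.Path a b) :
    σ • (⟨a, b, p⟩ : QuiverPath V) =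
      ⟨σ.toPrefunctor.obj a, σ.toPrefunctor.obj b, σ.toPrefunctor.mapPath p⟩ := rfl

theorem obj_bijective (σ : QuiverAut V) : Function.Bijective σ.toPrefunctor.obj := by
  refine Function.bijective_iff_has_inverse.2 ⟨(σ⁻¹).toPrefunctor.obj, fun a => ?_, fun a => ?_⟩
  · have h := congrArg (fun F : V ⥤q V => F.obj a) (toPrefunctor_mul σ⁻¹ σ)
    rw [inv_mul_cancel] at h
    exact h.symm
  · have h := congrArg (fun F : V ⥤q V => F.obj a) (toPrefunctor_mul σ σ⁻¹)
    rw [mul_inv_cancel] at h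
    exact h.symm

end QuiverAut

namespace PathAlgebra

variable {k : Type w} [CommRing k] {V : Type u} [Quiver.{v} V]

/-- The `k`-linear extension to `kQ` of the action of an automorphism on paths. -/
def autMap (σ : QuiverAut V) : PathAlgebra k V →ₗ[k] PathAlgebra k V :=
  Finsupp.lmapDomain k k fun p : QuiverPath V => σ • p

theorem autMap_ofPath (σ : QuiverAut V) (p : QuiverPath V) :
    autMap σ (ofPath p : PathAlgebra k V) = ofPath (σ • p) :=
  Finsupp.mapDomain_single

theorem autMap_pathMul (σ : QuiverAut V) (p q : QuiverPath V) :
    autMap σ (pathMul p q : PathAlgebra k V) = pathMul (σ • p) (σ • q) := by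
  obtain ⟨b, c, p⟩ := p
  obtain ⟨a, b', q⟩ := q
  by_cases h : b' = b
  · subst h
    rw [pathMul_comp, autMap_ofPath, QuiverAut.smul_mk, QuiverAut.smul_mk, QuiverAut.smul_mk,
      pathMul_comp, Prefunctor.mapPath_comp]
  · rw [pathMul_of_ne (by exact h), pathMul_of_ne, map_zero]
    exact fun h' => h (σ.obj_bijective.1 h')

variable [Fintype V]

/-- The automorphism group of the quiver acts on `kQ` by algebra automorphisms, through the
`k`-linear extension of its action on paths. -/
instance : MulSemiringAction (QuiverAut V) (PathAlgebra k V) where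
  smul σ x := autMap σ x
  one_smul x := by
    change autMap 1 x = x
    refine induction x (by simp) (fun x x' h h' => by simp [h, h']) fun c p => ?_
    rw [map_smul, autMap_ofPath, one_smul]
  mul_smul σ τ x := by
    change autMap (σ * τ) x = autMap σ (autMap τ x)
    refine induction x (by simp) (fun x x' h h' => by simp [h, h']) fun c p => ?_
    simp only [map_smul, autMap_ofPath, mul_smul]
  smul_zero σ := map_zero (autMap σ)
  smul_add σ := map_add (autMap σ)
  smul_one σ := by
    change autMap σ 1 = 1
    rw [one_def, map_sum]
    refine Eq.trans ?_ ((Equiv.ofBijective _ σ.obj_bijective).sum_comp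
      fun a => (ofPath ⟨a, a, Quiver.Path.nil⟩ : PathAlgebra k V))
    refine Finset.sum_congr rfl fun a _ => ?_
    rw [autMap_ofPath, QuiverAut.smul_mk, Prefunctor.mapPath_nil]
    rfl
  smul_mul σ x y := by
    change autMap σ (x * y) = autMap σ x * autMap σ y
    refine induction x (by simp) (fun x x' h h' => by simp [add_mul, h, h']) fun c p => ?_
    refine induction y (by simp)
      (fun y y' h h' => by rw [mul_add, map_add, h, h', map_add, mul_add]) fun d q => ?_
    simp only [smul_mul', mul_smul', map_smul, ofPath_mul_ofPath, autMap_pathMul, autMap_ofPath]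

theorem smul_ofPath (σ : QuiverAut V) (p : QuiverPath V) :
    σ • (ofPath p : PathAlgebra k V) = ofPath (σ • p) := autMap_ofPath σ p

end PathAlgebra

/-! ### Twisted modules and invariant modules -/

section Twist

variable {G : Type u} [Group G] {A : Type v} [Ring A] [MulSemiringAction G A]

/-- The twist `ᵍX` of an `A`-module `X` by `g`: the same abelian group, with the new action
`a · x = g⁻¹(a) x`. -/
def Twist (_g : G) (X : Type w) : Type w := X

instance (g : G) (X : Type w) [AddCommGroup X] : AddCommGroup (Twist g X) :=
  inferInstanceAs (AddCommGroup X)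

/-- The identity map from `X` to its twist. -/
def Twist.of (g : G) (X : Type w) [AddCommGroup X] : X ≃+ Twist g X := AddEquiv.refl X

instance (g : G) (X : Type w) [AddCommGroup X] [Module A X] : Module A (Twist g X) :=
  Module.compHom X (MulSemiringAction.toRingHom G A g⁻¹)

theorem Twist.smul_of (g : G) (X : Type w) [AddCommGroup X] [Module A X] (a : A) (x : X) :
    a • Twist.of g X x = Twist.of g X ((g⁻¹ • a) • x) := rfl

/-- A module is indecomposable if it is nonzero and is not the direct sum of two nonzero
submodules. -/
def IsIndecomposableModule (R : Type v) [Ring R] (X : Type w) [AddCommGroup X] [Module R X] :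
    Prop :=
  Nontrivial X ∧ ∀ Y Z : Submodule R X, IsCompl Y Z → Y = ⊥ ∨ Z = ⊥

variable (A) in
/-- `X` is `⟨σ⟩`-equivalent (isomorphically invariant): `^σX ≅ X` as `A`-modules. -/
def IsEquivariant (σ : G) (X : Type w) [AddCommGroup X] [Module A X] : Prop :=
  Nonempty (Twist σ X ≃ₗ[A] X)

variable (A) in
/-- `X` is an indecomposable `⟨σ⟩`-equivalent module: it is nonzero and `⟨σ⟩`-equivalent, and it is
not the direct sum of two nonzero `⟨σ⟩`-equivalent submodules. -/
def IsIndecomposableEquivariant (σ : G) (X : Type w) [AddCommGroup X] [Module A X] : Prop :=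
  Nontrivial X ∧ IsEquivariant A σ X ∧
    ∀ Y Z : Submodule A X, IsCompl Y Z → IsEquivariant A σ Y → IsEquivariant A σ Z →
      Y = ⊥ ∨ Z = ⊥

variable (A) in
/-- `X` is isomorphic to `Y ⊕ ^σY ⊕ ⋯ ⊕ ^{σ^{m-1}}Y` for a finitely generated indecomposable
`A`-module `Y`, where `m ≥ 1` is minimal with `^{σ^m}Y ≅ Y`. -/
def IsOrbitSum (σ : G) (X : Type w) [AddCommGroup X] [Module A X] : Prop :=
  ∃ (Y : Type w) (_ : AddCommGroup Y) (_ : Module A Y) (m : ℕ),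
    Module.Finite A Y ∧ IsIndecomposableModule A Y ∧
    1 ≤ m ∧ IsEquivariant A (σ ^ m) Y ∧ (∀ j : ℕ, 1 ≤ j → j < m → ¬ IsEquivariant A (σ ^ j) Y) ∧
    Nonempty (X ≃ₗ[A] ((i : Fin m) → Twist (σ ^ (i : ℕ)) Y))

/-! ### Skew group algebras and canonical induced modules -/

variable (A) in
/-- The skew group algebra `A # k⟨σ⟩`: the formal sums of `a # g` with `a ∈ A`, `g ∈ ⟨σ⟩`, and the
multiplication `(a # g)(b # h) = a g(b) # gh`. -/
abbrev SkewCyclicAlgebra (σ : G) : Type (max u v) := SkewMonoidAlgebra A (Subgroup.zpowers σ)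

variable {σ : G} {X : Type w} [AddCommGroup X] [Module A X]

/-- An isomorphism `φ : ^σX ≅ X`, as an automorphism of the abelian group `X`. -/
def untwist (φ : Twist σ X ≃ₗ[A] X) : X ≃ₗ[ℤ] X :=
  ((Twist.of σ X).trans φ.toAddEquiv).toIntLinearEquiv

theorem untwist_apply (φ : Twist σ X ≃ₗ[A] X) (x : X) : untwist φ x = φ (Twist.of σ X x) := rfl

theorem untwist_smul (φ : Twist σ X ≃ₗ[A] X) (a : A) (x : X) :
    untwist φ (a • x) = (σ • a) • untwist φ x := by
  have h := φ.map_smul (σ • a) (Twist.of σ X x)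
  rw [Twist.smul_of, inv_smul_smul] at h
  exact h

theorem untwist_inv_smul (φ : Twist σ X ≃ₗ[A] X) (a : A) (x : X) :
    (untwist φ)⁻¹ (a • x) = (σ⁻¹ • a) • (untwist φ)⁻¹ x := by
  apply (untwist φ).injective
  rw [untwist_smul, smul_inv_smul]
  change ((untwist φ) * (untwist φ)⁻¹) _ = _ • ((untwist φ) * (untwist φ)⁻¹) _
  rw [mul_inv_cancel]
  rfl

theorem untwist_zpow_smul (φ : Twist σ X ≃ₗ[A] X) (i : ℤ) :
    ∀ (a : A) (x : X), (untwist φ ^ i) (a • x) = (σ ^ i • a) • (untwist φ ^ i) x := by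
  induction i using Int.induction_on with
  | zero => intro a x; simp
  | succ n ih =>
    intro a x
    rw [zpow_add_one, zpow_add_one, mul_smul, LinearEquiv.mul_apply, LinearEquiv.mul_apply,
      untwist_smul, ih]
  | pred n ih =>
    intro a x
    rw [zpow_sub_one, zpow_sub_one, mul_smul, LinearEquiv.mul_apply, LinearEquiv.mul_apply,
      untwist_inv_smul, ih]

/-- The homomorphism `σ ^ i ↦ φ ^ i` from `⟨σ⟩` to the automorphisms of the abelian group `X`; it is
well defined because `φ ^ n = 1` for the order `n` of `σ`. -/
def cyclicAction (φ : Twist σ X ≃ₗ[A] X) (hφ : untwist φ ^ orderOf σ = 1) :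
    Subgroup.zpowers σ →* (X ≃ₗ[ℤ] X) :=
  monoidHomOfForallMemZpowers (g := (⟨σ, Subgroup.mem_zpowers σ⟩ : Subgroup.zpowers σ))
    (g' := untwist φ)
    (fun x => by
      obtain ⟨i, hi⟩ := Subgroup.mem_zpowers_iff.1 x.2
      exact Subgroup.mem_zpowers_iff.2 ⟨i, Subtype.ext hi⟩)
    (by rw [Subgroup.orderOf_mk]; exact orderOf_dvd_of_pow_eq_one hφ)

theorem cyclicAction_gen (φ : Twist σ X ≃ₗ[A] X) (hφ : untwist φ ^ orderOf σ = 1) :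
    cyclicAction φ hφ ⟨σ, Subgroup.mem_zpowers σ⟩ = untwist φ :=
  monoidHomOfForallMemZpowers_apply_gen _ _

theorem cyclicAction_smul (φ : Twist σ X ≃ₗ[A] X) (hφ : untwist φ ^ orderOf σ = 1)
    (g : Subgroup.zpowers σ) (a : A) (x : X) :
    cyclicAction φ hφ g (a • x) = (g • a) • cyclicAction φ hφ g x := by
  obtain ⟨_, i, rfl⟩ := g
  have h : (⟨σ ^ i, ⟨i, rfl⟩⟩ : Subgroup.zpowers σ) = ⟨σ, Subgroup.mem_zpowers σ⟩ ^ i := rfl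
  change cyclicAction φ hφ ⟨σ ^ i, ⟨i, rfl⟩⟩ (a • x) =
    (σ ^ i • a) • cyclicAction φ hφ ⟨σ ^ i, ⟨i, rfl⟩⟩ x
  rw [h, map_zpow, cyclicAction_gen, untwist_zpow_smul]

/-- The ring homomorphism `a # σ ^ i ↦ (x ↦ a φ ^ i (x))`. -/
def canonicalInducedHom (φ : Twist σ X ≃ₗ[A] X) (hφ : untwist φ ^ orderOf σ = 1) :
    SkewCyclicAlgebra A σ →+* Module.End ℤ X :=
  SkewMonoidAlgebra.liftNCRingHom (Module.toModuleEnd ℤ (S := A) X)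
    ((LinearEquiv.automorphismGroup.toLinearMapMonoidHom).comp (cyclicAction φ hφ))
    (fun {a g} => LinearMap.ext fun x => (cyclicAction_smul φ hφ g a x).symm)

/-- The canonical induced `A # k⟨σ⟩`-module on an `A`-module `X`, defined by an isomorphism
`φ : ^σX ≅ X` with `φ ^ n = 1` for the order `n` of `σ`: the element `a # σ ^ i` acts as
`x ↦ a φ ^ i (x)`. -/
@[reducible]
def canonicalInducedModule (φ : Twist σ X ≃ₗ[A] X) (hφ : untwist φ ^ orderOf σ = 1) :
    Module (SkewCyclicAlgebra A σ) X :=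
  Module.compHom X (canonicalInducedHom φ hφ)

theorem canonicalInducedModule_single_smul (φ : Twist σ X ≃ₗ[A] X)
    (hφ : untwist φ ^ orderOf σ = 1) (a : A) (g : Subgroup.zpowers σ) (x : X) :
    letI := canonicalInducedModule φ hφ
    (SkewMonoidAlgebra.single g a : SkewCyclicAlgebra A σ) • x = a • cyclicAction φ hφ g x := by
  change canonicalInducedHom φ hφ (SkewMonoidAlgebra.single g a) x = _
  unfold canonicalInducedHom
  erw [SkewMonoidAlgebra.liftNC_single]
  rfl

end Twist

end

/-!
Twisting by `g` leaves endomorphism rings unchanged, and an isomorphism `^gX ≅ X` is the same thing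
as a bijection `X → X` that is semilinear over `g`. As `kQ` is finite-dimensional (a finite quiver
without oriented cycles has finitely many paths), finitely generated modules have finite length, and
the proof rests on three facts about a module `X` of finite length.

* By Fitting's lemma, indecomposable modules have local endomorphism rings, and so does a module
  with a map `φ` preserving no nontrivial decomposition, if only the endomorphisms commuting with
  `φ` are admitted (`IsIndecomposableUnder.isLocalRing_commutant`). With the exchange property
  (`isDirectSummand_pi`), this replaces the Krull–Schmidt theorem: an equivalent module `X` with an
  indecomposable summand `Y` has the summand `Y ⊕ ^σY ⊕ ⋯ ⊕ ^{σ^{m-1}}Y`, its terms being pairwise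
  non-isomorphic (`IsDirectSummand.pi_twist`).
* If `X` is equivalent, then `^σX ≅ X` can be chosen with `n`-th power `1`: for any choice `φ`, the
  map `φ ^ n` is an invertible endomorphism and has an `n`-th root that is a polynomial in it
  (`exists_aeval_pow_eq`, `IsEquivariant.exists_pow_eq_one`).
* Let `φ` on `X` and `ψ` on `U` be semilinear over `σ` with `n`-th power `1`. Averaging `f' ∘ f` for
  `f : X → U` and `f' : U → X` over the conjugations by `φ ^ i` gives, up to a nonzero factor, the
  sum of the products `f'_χ⁻¹ ∘ f_χ` of the weight components of `f'` and `f` (`sum_bilin`). These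
  products commute with `φ`. So if the ring of such endomorphisms is local and the average is
  invertible, a single component `f_χ` splits, compatibly with `φ` and `ψ` up to a scalar
  (`exists_semiinvariant_bijective`).

The last fact shows that a module `X` over the skew group algebra that is indecomposable is also
indecomposable equivalent: for `X = U ⊕ W` with `U` and `W` equivalent, the averages of the two
projections add up to `n`, so one is invertible and `X` embeds into `U` or into `W`. The converse
is immediate, since summands over the skew group algebra are equivalent. An orbit sum is
indecomposable equivalent because `Y` is a summand of one of two complementary summands `U` and `W`,
and the whole orbit sum is then a summand of the same one. Conversely, an indecomposable equivalent
`X` has an orbit sum `U` as a summand, and averaging turns the inclusion of `U` into one whose image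
and complement are both equivalent; hence `U ≅ X`.
-/

noncomputable section

universe u v w

/-! ### Finiteness of the path algebra -/

/-- Without oriented cycles, "there is an arrow `a ⟶ b`" is well-founded on the finite vertex set, so
the paths ending at `b` can be counted by induction along their last arrow. -/
theorem NoOrientedCycles.finite_path {V : Type u} [Quiver.{v} V] [Finite V]
    [∀ a b : V, Finite (a ⟶ b)] (hV : NoOrientedCycles V) (a b : V) :
    Finite (Quiver.Path a b) := by
  let r : V → V → Prop := fun a b => ∃ p : Quiver.Path a b, 0 < p.length
  have : IsTrans V r := ⟨fun a b c ⟨p, hp⟩ ⟨q, hq⟩ => ⟨p.comp q, by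
    rw [Quiver.Path.length_comp]; omega⟩⟩
  have : Std.Irrefl r := ⟨fun a ⟨p, hp⟩ => by rw [hV a p] at hp; omega⟩
  have hwf : WellFounded r := Finite.wellFounded_of_trans_of_irrefl r
  induction b using hwf.induction with
  | _ b ih =>
    have h (c : V) : Finite (Σ _ : c ⟶ b, Quiver.Path a c) :=
      @Finite.instSigma _ _ _ fun e => ih c ⟨e.toPath, by simp⟩
    have : Subsingleton (PLift (a = b)) := ⟨fun ⟨_⟩ ⟨_⟩ => rfl⟩
    refine Finite.of_surjective
      (fun x : PLift (a = b) ⊕ Σ c : V, Σ _ : c ⟶ b, Quiver.Path a c =>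
        match x with
        | .inl h => (Quiver.Path.nil : Quiver.Path a a).cast rfl h.down
        | .inr ⟨_, e, p⟩ => p.cons e) fun p => ?_
    cases p with
    | nil => exact ⟨.inl ⟨rfl⟩, rfl⟩
    | cons p e => exact ⟨.inr ⟨_, e, p⟩, rfl⟩

theorem PathAlgebra.finite {k : Type w} [CommRing k] {V : Type u} [Quiver.{v} V] [Fintype V]
    [∀ a b : V, Finite (a ⟶ b)] (hV : NoOrientedCycles V) : Module.Finite k (PathAlgebra k V) := by
  have := hV.finite_path
  have : Finite (QuiverPath V) := inferInstance
  exact inferInstanceAs (Module.Finite k (QuiverPath V →₀ k))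

instance PathAlgebra.smulCommClass {k : Type w} [CommRing k] {V : Type u} [Quiver.{v} V]
    [Fintype V] : SMulCommClass (QuiverAut V) k (PathAlgebra k V) :=
  ⟨fun σ c x => map_smul (PathAlgebra.autMap σ) c x⟩

/-! ### Local endomorphism rings -/

section LocalEnd

variable {R : Type u} [Ring R] {M : Type v} [AddCommGroup M] [Module R M]

/-- Fitting's lemma: an endomorphism of a module of finite length whose Fitting decompositions are
all trivial is nilpotent or invertible. -/
theorem Module.End.isUnit_or_isNilpotent_of_fitting [IsArtinian R M] [IsNoetherian R M]
    (f : Module.End R M)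
    (h : ∀ n : ℕ, IsCompl (LinearMap.ker (f ^ n)) (LinearMap.range (f ^ n)) →
      LinearMap.ker (f ^ n) = ⊥ ∨ LinearMap.range (f ^ n) = ⊥) :
    IsUnit f ∨ IsNilpotent f := by
  obtain ⟨N, hN⟩ := Filter.eventually_atTop.1 f.eventually_isCompl_ker_pow_range_pow
  have hc := hN (N + 1) (by omega)
  rcases h _ hc with h | h
  · left
    rw [Module.End.isUnit_iff]
    refine IsArtinian.bijective_of_injective_endomorphism f ?_
    have hinj : Function.Injective (f ^ (N + 1)) := LinearMap.ker_eq_bot.1 h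
    rw [pow_succ, Module.End.mul_eq_comp, LinearMap.coe_comp] at hinj
    exact hinj.of_comp
  · exact Or.inr ⟨N + 1, LinearMap.range_eq_bot.1 h⟩

theorem IsLocalRing.of_isUnit_or_isNilpotent {S : Type*} [Ring S] [Nontrivial S]
    (h : ∀ a : S, IsUnit a ∨ IsNilpotent a) : IsLocalRing S :=
  IsLocalRing.of_isUnit_or_isUnit_one_sub_self fun a =>
    (h a).imp_right fun ha => ha.isUnit_one_sub

theorem IsLocalRing.of_ringEquiv {S T : Type*} [Ring S] [Ring T] [IsLocalRing S] (e : S ≃+* T) :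
    IsLocalRing T := by
  have := e.injective.nontrivial
  refine IsLocalRing.of_isUnit_or_isUnit_one_sub_self fun a => ?_
  have h := IsLocalRing.isUnit_or_isUnit_of_add_one (add_sub_cancel (e.symm a) 1)
  refine h.imp (fun h => ?_) fun h => ?_
  · simpa using h.map e
  · simpa using h.map e

theorem IsIndecomposableModule.isLocalRing_end [IsArtinian R M] [IsNoetherian R M]
    (h : IsIndecomposableModule R M) : IsLocalRing (Module.End R M) := by
  have := h.1
  exact .of_isUnit_or_isNilpotent fun f => f.isUnit_or_isNilpotent_of_fitting fun n => h.2 _ _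

/-- The ring of the endomorphisms of a module that commute with a given additive map `φ`. -/
def commutant (R : Type u) [Ring R] [Module R M] (φ : M →+ M) : Subring (Module.End R M) where
  carrier := {f | ∀ x, f (φ x) = φ (f x)}
  mul_mem' {f g} hf hg x := by simp [hg x, hf (g x)]
  one_mem' x := rfl
  add_mem' {f g} hf hg x := by simp [hf x, hg x]
  zero_mem' x := by simp
  neg_mem' {f} hf x := by simp [hf x]

/-- `φ` preserves no nontrivial direct sum decomposition of the module `M` into two submodules. -/
def IsIndecomposableUnder (R : Type u) [Ring R] [Module R M] (φ : M →+ M) : Prop :=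
  ∀ Y Z : Submodule R M, IsCompl Y Z → (∀ y ∈ Y, φ y ∈ Y) → (∀ z ∈ Z, φ z ∈ Z) → Y = ⊥ ∨ Z = ⊥

theorem commutant_isUnit_of_isUnit {φ : M →+ M} {f : commutant R φ}
    (hf : IsUnit (f : Module.End R M)) : IsUnit f := by
  obtain ⟨u, hu⟩ := hf
  have h1 (x : M) : (f : Module.End R M) ((u⁻¹ : (Module.End R M)ˣ).val x) = x := by
    rw [← hu, ← Module.End.mul_apply, Units.mul_inv, Module.End.one_apply]
  have h2 (x : M) : (u⁻¹ : (Module.End R M)ˣ).val ((f : Module.End R M) x) = x := by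
    rw [← hu, ← Module.End.mul_apply, Units.inv_mul, Module.End.one_apply]
  have hinv : (u⁻¹ : (Module.End R M)ˣ).val ∈ commutant R φ := fun x => by
    conv_lhs => rw [← h1 x, ← f.2, h2]
  exact ⟨⟨f, ⟨_, hinv⟩, Subtype.ext (LinearMap.ext h1), Subtype.ext (LinearMap.ext h2)⟩, rfl⟩

theorem IsIndecomposableUnder.isLocalRing_commutant [IsArtinian R M] [IsNoetherian R M]
    [Nontrivial M] {φ : M →+ M} (h : IsIndecomposableUnder R φ) :
    IsLocalRing (commutant R φ) := by
  refine .of_isUnit_or_isNilpotent fun f => ?_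
  have hpow (n : ℕ) (x : M) : ((f : Module.End R M) ^ n) (φ x) = φ (((f : Module.End R M) ^ n) x) :=
    (f ^ n).2 x
  have hf : IsUnit (f : Module.End R M) ∨ IsNilpotent (f : Module.End R M) := by
    refine Module.End.isUnit_or_isNilpotent_of_fitting _ fun n hn => h _ _ hn ?_ ?_
    · intro y hy
      rw [LinearMap.mem_ker] at hy ⊢
      rw [hpow, hy, map_zero]
    · rintro _ ⟨x, rfl⟩
      exact ⟨φ x, hpow n x⟩
  refine hf.imp commutant_isUnit_of_isUnit fun ⟨n, hn⟩ => ⟨n, Subtype.ext hn⟩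

end LocalEnd

/-! ### Direct summands -/

section Summand

variable {R : Type u} [Ring R]

/-- `Y` is (isomorphic to) a direct summand of `X`, expressed by a split injection. -/
def IsDirectSummand (R : Type u) [Ring R] (Y : Type*) (X : Type*) [AddCommGroup Y] [Module R Y]
    [AddCommGroup X] [Module R X] : Prop :=
  ∃ (i : Y →ₗ[R] X) (p : X →ₗ[R] Y), p ∘ₗ i = LinearMap.id

variable {X Y Z : Type*} [AddCommGroup X] [Module R X] [AddCommGroup Y] [Module R Y]
  [AddCommGroup Z] [Module R Z]

theorem IsDirectSummand.trans (h : IsDirectSummand R X Y) (h' : IsDirectSummand R Y Z) :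
    IsDirectSummand R X Z := by
  obtain ⟨i, p, h⟩ := h
  obtain ⟨j, q, h'⟩ := h'
  refine ⟨j ∘ₗ i, p ∘ₗ q, ?_⟩
  rw [LinearMap.comp_assoc, ← LinearMap.comp_assoc i, h', LinearMap.id_comp, h]

theorem LinearEquiv.isDirectSummand (e : X ≃ₗ[R] Y) : IsDirectSummand R X Y :=
  ⟨e, e.symm, by ext; simp⟩

theorem IsDirectSummand.of_isUnit {i : Y →ₗ[R] X} {p : X →ₗ[R] Y}
    (h : IsUnit (p ∘ₗ i : Module.End R Y)) : IsDirectSummand R Y X := by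
  obtain ⟨u, hu⟩ := h
  refine ⟨i, (u⁻¹ : (Module.End R Y)ˣ).val ∘ₗ p, ?_⟩
  rw [LinearMap.comp_assoc, ← hu]
  exact u.inv_mul

theorem IsCompl.isDirectSummand {U W : Submodule R X} (h : IsCompl U W) : IsDirectSummand R U X :=
  ⟨U.subtype, U.projectionOnto W h, by ext; simp⟩

/-- A nonzero direct summand of a module with local endomorphism ring is the whole module. -/
theorem IsDirectSummand.nonempty_linearEquiv [Nontrivial Y] [IsLocalRing (Module.End R X)]
    (h : IsDirectSummand R Y X) : Nonempty (Y ≃ₗ[R] X) := by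
  obtain ⟨i, p, h⟩ := h
  have hpi (y : Y) : p (i y) = y := LinearMap.congr_fun h y
  let e : Module.End R X := i ∘ₗ p
  have he : e * (1 - e) = 0 := by
    ext x
    simp [e, hpi]
  rcases IsLocalRing.isUnit_or_isUnit_of_isUnit_add (a := e) (b := 1 - e) (by simp) with hu | hu
  · have h1 : 1 - e = 0 := (hu.mul_right_eq_zero).1 he
    refine ⟨LinearEquiv.ofLinearMap i p ?_ h⟩
    exact (sub_eq_zero.1 h1).symm
  · have h1 : e = 0 := (hu.mul_left_eq_zero).1 he
    obtain ⟨y, hy⟩ := exists_ne (0 : Y)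
    refine absurd ?_ hy
    have := LinearMap.congr_fun h1 (i y)
    simp only [e, LinearMap.comp_apply, hpi, LinearMap.zero_apply] at this
    rw [← hpi y, this, map_zero]

/-- A module with local endomorphism ring that is a summand of `U ⊕ W` is a summand of `U` or
of `W`. -/
theorem IsDirectSummand.of_isCompl [IsLocalRing (Module.End R Y)] {U W : Submodule R X}
    (hUW : IsCompl U W) (h : IsDirectSummand R Y X) :
    IsDirectSummand R Y U ∨ IsDirectSummand R Y W := by
  obtain ⟨i, p, h⟩ := h
  have hsum : (p ∘ₗ U.subtype) ∘ₗ (U.projectionOnto W hUW ∘ₗ i) +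
      (p ∘ₗ W.subtype) ∘ₗ (W.projectionOnto U hUW.symm ∘ₗ i) = (1 : Module.End R Y) := by
    ext y
    simp only [LinearMap.add_apply, LinearMap.comp_apply, Submodule.subtype_apply, ← map_add]
    have := Submodule.projection_add_projection_eq_self hUW (i y)
    rw [Submodule.projection_apply, Submodule.projection_apply] at this
    rw [this]
    exact LinearMap.congr_fun h y
  rcases IsLocalRing.isUnit_or_isUnit_of_add_one hsum with hu | hu
  · exact Or.inl (.of_isUnit hu)
  · exact Or.inr (.of_isUnit hu)

/-- The exchange step of the Krull–Schmidt theorem: pairwise non-isomorphic modules with local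
endomorphism rings that are summands of `U` one by one are summands of `U` simultaneously. -/
theorem isDirectSummand_pi {m : ℕ} (Y : Fin m → Type v) [∀ i, AddCommGroup (Y i)]
    [∀ i, Module R (Y i)] (hloc : ∀ i, IsLocalRing (Module.End R (Y i)))
    (hY : ∀ i j, i ≠ j → IsEmpty (Y i ≃ₗ[R] Y j))
    (U : Type w) [AddCommGroup U] [Module R U] (h : ∀ i, IsDirectSummand R (Y i) U) :
    IsDirectSummand R (∀ i, Y i) U := by
  induction m generalizing U with
  | zero => exact ⟨0, 0, Subsingleton.elim _ _⟩
  | succ m ih =>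
    obtain ⟨i₀, p₀, h₀⟩ := h 0
    have h₀' (y : Y 0) : p₀ (i₀ y) = y := LinearMap.congr_fun h₀ y
    -- `U = i₀(Y 0) ⊕ ker p₀`
    let q : U →ₗ[R] LinearMap.ker p₀ :=
      (LinearMap.id - i₀ ∘ₗ p₀).codRestrict _ fun u => by simp [h₀']
    have hq (u : U) : (q u : U) = u - i₀ (p₀ u) := rfl
    have hsucc (j : Fin m) : IsDirectSummand R (Y j.succ) (LinearMap.ker p₀) := by
      obtain ⟨i, p, h⟩ := h j.succ
      have hsum : (p ∘ₗ i₀) ∘ₗ (p₀ ∘ₗ i) + (p ∘ₗ (LinearMap.ker p₀).subtype) ∘ₗ (q ∘ₗ i) =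
          (1 : Module.End R (Y j.succ)) := by
        ext y
        simp only [LinearMap.add_apply, LinearMap.comp_apply, Submodule.subtype_apply, hq,
          ← map_add, add_sub_cancel]
        exact LinearMap.congr_fun h y
      have := hloc j.succ
      have := hloc 0
      have : Nontrivial (Y j.succ) := by
        by_contra hn
        rw [not_nontrivial_iff_subsingleton] at hn
        exact one_ne_zero (α := Module.End R (Y j.succ)) (Subsingleton.elim _ _)
      -- a composite through `Y 0` cannot be invertible, as `Y j.succ` is not a summand of `Y 0`
      rcases IsLocalRing.isUnit_or_isUnit_of_add_one hsum with hu | hu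
      · obtain ⟨e⟩ := (IsDirectSummand.of_isUnit hu).nonempty_linearEquiv
        exact ((hY j.succ 0 (Fin.succ_ne_zero j)).false e).elim
      · exact .of_isUnit hu
    obtain ⟨i', p', h'⟩ := ih (fun j => Y j.succ) (fun j => hloc j.succ)
      (fun j l hjl => hY _ _ fun e => hjl (Fin.succ_injective _ e)) _ hsucc
    refine ⟨i₀ ∘ₗ LinearMap.proj 0 +
        (LinearMap.ker p₀).subtype ∘ₗ i' ∘ₗ LinearMap.pi fun j => LinearMap.proj j.succ,
      LinearMap.pi (Fin.cons (α := fun j => U →ₗ[R] Y j) p₀ fun j => LinearMap.proj j ∘ₗ p' ∘ₗ q),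
      ?_⟩
    refine LinearMap.ext fun y => funext fun j => ?_
    have hker (z : LinearMap.ker p₀) : p₀ z = 0 := z.2
    have hqz (z : LinearMap.ker p₀) : q z = z := Subtype.ext (by simp [hq, hker])
    have hqi (y : Y 0) : q (i₀ y) = 0 := Subtype.ext (by simp [hq, h₀'])
    cases j using Fin.cases with
    | zero => simp [h₀', hker]
    | succ j =>
      have := congrFun (LinearMap.congr_fun h'
        (LinearMap.pi (R := R) (fun j => LinearMap.proj j.succ) y)) j
      simpa [hqz, hqi] using this

/-- A nonzero Artinian module has an indecomposable direct summand: a minimal nonzero one. -/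
theorem exists_indecomposable_isDirectSummand [IsArtinian R X] [Nontrivial X] :
    ∃ Y : Submodule R X, IsIndecomposableModule R Y ∧ IsDirectSummand R Y X := by
  obtain ⟨Y, ⟨hY0, hY⟩, hmin⟩ := WellFounded.has_min (wellFounded_lt (α := Submodule R X))
    {Y | Y ≠ ⊥ ∧ IsDirectSummand R Y X}
    ⟨⊤, top_ne_bot, Submodule.topEquiv.isDirectSummand⟩
  refine ⟨Y, ⟨Submodule.nontrivial_iff_ne_bot.2 hY0, fun P Q hPQ => ?_⟩, hY⟩
  by_contra! hne
  refine hmin (P.map Y.subtype) ⟨?_, ?_⟩ ?_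
  · exact fun h => hne.1
      (Submodule.map_injective_of_injective Y.injective_subtype (h.trans (Submodule.map_bot _).symm))
  · exact ((P.equivMapOfInjective _ Y.injective_subtype).symm.isDirectSummand.trans
      hPQ.isDirectSummand).trans hY
  · refine lt_of_le_of_ne (Submodule.map_subtype_le Y P) fun h => hne.2 ?_
    have : P = ⊤ := by
      rw [← Submodule.comap_map_eq_of_injective Y.injective_subtype P, h]
      exact Submodule.comap_subtype_self Y
    exact bot_unique (this ▸ hPQ.disjoint |>.le_bot |>.trans' (by simp))

theorem LinearMap.isCompl_range_ker_of_bijective {i : Y →ₗ[R] X} {p : X →ₗ[R] Y}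
    (h : Function.Bijective (p ∘ₗ i)) : IsCompl (LinearMap.range i) (LinearMap.ker p) := by
  refine ⟨Submodule.disjoint_def.2 ?_, codisjoint_iff.2 (eq_top_iff.2 fun x _ => ?_)⟩
  · rintro _ ⟨y, rfl⟩ hy
    rw [h.1 (a₁ := y) (a₂ := 0) (by simpa using hy), map_zero]
  · obtain ⟨y, hy⟩ := h.2 (p x)
    refine Submodule.mem_sup.2 ⟨i y, ⟨y, rfl⟩, x - i y, ?_, by abel⟩
    rw [LinearMap.mem_ker, map_sub, ← hy, LinearMap.comp_apply, sub_self]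

/-- An Artinian module does not embed into a proper submodule. -/
theorem Submodule.eq_top_of_injective [IsArtinian R X] {U : Submodule R X}
    (i : X →ₗ[R] U) (hi : Function.Injective i) : U = ⊤ := by
  have hs := IsArtinian.surjective_of_injective_endomorphism (U.subtype ∘ₗ i)
    (U.injective_subtype.comp hi)
  refine eq_top_iff.2 fun x _ => ?_
  obtain ⟨y, rfl⟩ := hs x
  exact (i y).2

end Summand

/-! ### Twists and semilinear maps -/

section Semilinear

variable {G : Type*} [Group G] {A : Type*} [Ring A] [MulSemiringAction G A]

/-- An additive bijection that is semilinear over `g` is an isomorphism from the twist. -/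
def Twist.equivOfSemilinear {g : G} {X U : Type*} [AddCommGroup X] [Module A X] [AddCommGroup U]
    [Module A U] (e : X ≃+ U) (he : ∀ (a : A) (x : X), e (a • x) = (g • a) • e x) :
    Twist g X ≃ₗ[A] U :=
  { (Twist.of g X).symm.trans e with
    map_smul' := fun a x => (he (g⁻¹ • a) ((Twist.of g X).symm x)).trans (by
      rw [smul_inv_smul]; rfl) }

/-- Twisting is functorial. -/
def Twist.map (g : G) {X U : Type*} [AddCommGroup X] [Module A X] [AddCommGroup U]
    [Module A U] (f : X →ₗ[A] U) : Twist g X →ₗ[A] Twist g U where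
  toFun x := Twist.of g U (f ((Twist.of g X).symm x))
  map_add' x y := by simp
  map_smul' a x := congrArg (Twist.of g U) (f.map_smul (g⁻¹ • a) ((Twist.of g X).symm x))

/-- A module and its twist have the same endomorphisms. -/
def Twist.endEquiv (g : G) (X : Type*) [AddCommGroup X] [Module A X] :
    Module.End A X ≃+* Module.End A (Twist g X) where
  toFun f := Twist.map g f
  invFun f :=
    { toFun := fun x => (Twist.of g X).symm (f (Twist.of g X x))
      map_add' := fun x y => by simp
      map_smul' := fun a x => by
        have h := f.map_smul (g • a) (Twist.of g X x)
        rw [Twist.smul_of, inv_smul_smul] at h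
        rw [h]
        exact congrArg (fun b : A => b • (Twist.of g X).symm (f (Twist.of g X x)))
          (inv_smul_smul g a) }
  left_inv _ := rfl
  right_inv _ := rfl
  map_add' _ _ := rfl
  map_mul' _ _ := rfl

theorem IsDirectSummand.twist {X Y : Type*} [AddCommGroup X] [Module A X] [AddCommGroup Y]
    [Module A Y] (h : IsDirectSummand A Y X) {g : G} (hX : IsEquivariant A g X) :
    IsDirectSummand A (Twist g Y) X := by
  obtain ⟨i, p, h⟩ := h
  refine IsDirectSummand.trans ⟨Twist.map g i, Twist.map g p, ?_⟩ hX.some.isDirectSummand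
  exact LinearMap.ext fun y => congrArg (Twist.of g Y) (LinearMap.congr_fun h _)

/-- `φ` is semilinear over the action of `g` on `A`. -/
def IsSemilinearOver (A : Type*) [Ring A] [MulSemiringAction G A] {X : Type*} [AddCommGroup X]
    [Module A X] (g : G) (φ : X → X) : Prop :=
  ∀ (a : A) (x : X), φ (a • x) = (g • a) • φ x

variable {X : Type*} [AddCommGroup X] [Module A X]

theorem isEquivariant_iff_exists_addEquiv {g : G} :
    IsEquivariant A g X ↔ ∃ φ : X ≃+ X, IsSemilinearOver A g φ :=
  ⟨fun ⟨φ⟩ => ⟨(untwist φ).toAddEquiv, untwist_smul φ⟩,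
    fun ⟨φ, hφ⟩ => ⟨Twist.equivOfSemilinear φ hφ⟩⟩

theorem IsEquivariant.one : IsEquivariant A (1 : G) X :=
  isEquivariant_iff_exists_addEquiv.2 ⟨AddEquiv.refl X, fun a x => by simp⟩

theorem IsEquivariant.pow {g : G} (h : IsEquivariant A g X) (i : ℕ) :
    IsEquivariant A (g ^ i) X := by
  induction i with
  | zero => simpa using IsEquivariant.one
  | succ i ih =>
    obtain ⟨φ, hφ⟩ := isEquivariant_iff_exists_addEquiv.1 h
    obtain ⟨ψ, hψ⟩ := isEquivariant_iff_exists_addEquiv.1 ih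
    refine isEquivariant_iff_exists_addEquiv.2 ⟨φ.trans ψ, fun a x => ?_⟩
    rw [AddEquiv.trans_apply, AddEquiv.trans_apply, hφ, hψ, pow_succ, mul_smul]

theorem IsEquivariant.congr {g : G} {U : Type*} [AddCommGroup U] [Module A U] (e : X ≃ₗ[A] U)
    (h : IsEquivariant A g X) : IsEquivariant A g U := by
  obtain ⟨φ, hφ⟩ := isEquivariant_iff_exists_addEquiv.1 h
  refine isEquivariant_iff_exists_addEquiv.2
    ⟨(e.symm.toAddEquiv.trans φ).trans e.toAddEquiv, fun a x => ?_⟩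
  change e (φ (e.symm (a • x))) = (g • a) • e (φ (e.symm x))
  rw [map_smul, hφ, map_smul]

/-- Two isomorphic twists `^{g^i}Y ≅ ^{g^j}Y` give `^{g^(j-i)}Y ≅ Y`. -/
theorem IsEquivariant.of_twist_equiv_twist {g : G} {i j : ℕ} (hij : i ≤ j)
    (e : Twist (g ^ i) X ≃ₗ[A] Twist (g ^ j) X) : IsEquivariant A (g ^ (j - i)) X := by
  let φ : X ≃+ X := ((Twist.of (g ^ i) X).trans e.toAddEquiv).trans (Twist.of (g ^ j) X).symm
  have hφ (a : A) (x : X) : φ (((g ^ i)⁻¹ • a) • x) = ((g ^ j)⁻¹ • a) • φ x :=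
    congrArg (Twist.of (g ^ j) X).symm (e.map_smul a (Twist.of (g ^ i) X x))
  refine isEquivariant_iff_exists_addEquiv.2 ⟨φ.symm, fun a x => ?_⟩
  apply φ.injective
  have h := hφ (g ^ j • a) (φ.symm x)
  rw [inv_smul_smul, φ.apply_symm_apply, ← mul_smul] at h
  rw [φ.apply_symm_apply, ← h, ← inv_mul_eq_of_eq_mul (pow_mul_pow_sub g hij).symm]

theorem isEquivariant_of_isCompl {g : G} {φ : X ≃+ X} (hφ : IsSemilinearOver A g φ)
    {Y Z : Submodule A X} (h : IsCompl Y Z) (hY : ∀ y ∈ Y, φ y ∈ Y) (hZ : ∀ z ∈ Z, φ z ∈ Z) :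
    IsEquivariant A g Y := by
  refine isEquivariant_iff_exists_addEquiv.2 ⟨AddEquiv.ofBijective
    (((φ : X →+ X).comp Y.subtype.toAddMonoidHom).codRestrict Y fun y => hY y y.2)
    ⟨fun y y' hyy' => ?_, fun y => ?_⟩, fun a y => Subtype.ext (hφ a y)⟩
  · exact Subtype.ext (φ.injective (congrArg Subtype.val hyy'))
  · -- the `Z`-component of the preimage of `y ∈ Y` is mapped to `Y ∩ Z = 0`
    obtain ⟨a, ha, b, hb, hab⟩ := Submodule.mem_sup.1
      (h.sup_eq_top ▸ Submodule.mem_top : φ.symm y ∈ Y ⊔ Z)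
    have hφab : φ a + φ b = y := by rw [← map_add, hab, φ.apply_symm_apply]
    have hb0 : φ b = 0 := by
      refine (Submodule.disjoint_def.1 h.disjoint) _ ?_ (hZ b hb)
      rw [← sub_eq_of_eq_add' hφab.symm]
      exact Y.sub_mem y.2 (hY a ha)
    exact ⟨⟨a, ha⟩, Subtype.ext (by rw [← hφab, hb0, add_zero]; rfl)⟩

theorem IsIndecomposableEquivariant.isIndecomposableUnder {g : G}
    (h : IsIndecomposableEquivariant A g X) {φ : X ≃+ X} (hφ : IsSemilinearOver A g φ) :
    IsIndecomposableUnder A (φ : X →+ X) := fun Y Z hYZ hY hZ =>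
  h.2.2 Y Z hYZ (isEquivariant_of_isCompl hφ hYZ hY hZ) (isEquivariant_of_isCompl hφ hYZ.symm hZ hY)

end Semilinear

/-! ### Roots of invertible operators -/

section Root

open Polynomial

/-- Over an algebraically closed field, an invertible element of a finite-dimensional algebra has an
`n`-th root that is a polynomial in it, if `n` is invertible: interpolating `n`-th roots of the
eigenvalues gives a root up to a nilpotent, and Newton's method makes it exact. -/
theorem exists_aeval_pow_eq {k : Type*} [Field k] [IsAlgClosed k] {S : Type*} [Ring S]
    [Algebra k S] [Module.Finite k S] {θ : S} (hθ : IsUnit θ) {n : ℕ} (hn : (n : k) ≠ 0) :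
    ∃ p : k[X], aeval θ p ^ n = θ := by
  classical
  have hn0 : 0 < n := Nat.pos_of_ne_zero fun h => hn (by rw [h, Nat.cast_zero])
  have hint : IsIntegral k θ := .of_finite k θ
  set q := minpoly k θ with hq
  have hq0 : q ≠ 0 := minpoly.ne_zero hint
  choose r hr using fun x : k => IsAlgClosed.exists_pow_nat_eq x hn0
  let p₀ : k[X] := Lagrange.interpolate q.roots.toFinset id r
  have hp₀ : ∀ c ∈ q.roots, (p₀ ^ n - X).IsRoot c := by
    intro c hc
    have : p₀.eval c = r c :=
      Lagrange.eval_interpolate_at_node r Function.injective_id.injOn (Multiset.mem_toFinset.2 hc)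
    simp [this, hr]
  have hdvd : q ∣ (p₀ ^ n - X) ^ q.roots.card := by
    have hsplit : q = (q.roots.map fun a => X - C a).prod :=
      (IsAlgClosed.splits q).eq_prod_roots_of_monic (minpoly.monic hint)
    have h := Multiset.prod_dvd_prod_of_dvd (S := q.roots) (fun a => X - C a)
      (fun _ => p₀ ^ n - X) fun a ha => dvd_iff_isRoot.2 (hp₀ a ha)
    rw [← hsplit] at h
    simpa using h
  let B := k[X] ⧸ Ideal.span {q}
  let mk : k[X] →+* B := Ideal.Quotient.mk _
  have hmk (f : k[X]) : mk f = 0 ↔ q ∣ f :=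
    Ideal.Quotient.eq_zero_iff_mem.trans Ideal.mem_span_singleton
  have hnil : IsNilpotent (mk p₀ ^ n - mk X) :=
    ⟨q.roots.card, by rw [← map_pow, ← map_sub, ← map_pow, hmk]; exact hdvd⟩
  -- `X` is invertible modulo `q`, because `θ` is invertible
  have hX : IsUnit (mk X) := by
    have hc : IsCoprime X q := by
      refine (Polynomial.irreducible_X.coprime_iff_not_dvd).2 fun ⟨f, hf⟩ => ?_
      have h0 := minpoly.aeval k θ
      rw [← hq, hf, map_mul, aeval_X, hθ.mul_right_eq_zero] at h0
      obtain ⟨e, he⟩ := minpoly.dvd k θ h0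
      rw [← hq] at he
      have hX1 : q * (X * e) = q * 1 := by rw [mul_one, mul_left_comm, ← he, ← hf]
      exact Polynomial.not_isUnit_X (.of_mul_eq_one _ (mul_left_cancel₀ hq0 hX1))
    obtain ⟨a, b, hab⟩ := hc
    refine IsUnit.of_mul_eq_one_right (mk a) ?_
    rw [← map_mul, ← map_one mk, ← hab, map_add, (hmk (b * q)).2 (dvd_mul_left _ _), add_zero]
  have hroot : IsUnit (mk p₀) := by
    rw [← isUnit_pow_iff hn0.ne']
    rw [← sub_add_cancel (mk p₀ ^ n) (mk X)]
    exact hnil.isUnit_add_right_of_commute hX (Commute.all _ _)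
  obtain ⟨s, ⟨-, hs⟩, -⟩ := existsUnique_nilpotent_sub_and_aeval_eq_zero
    (P := (X ^ n - C (mk X) : B[X])) (x := mk p₀) (by simpa using hnil) (by
      have : IsUnit (n : B) := by
        have := (IsUnit.mk0 _ hn).map (mk.comp C)
        simpa using this
      simpa [derivative_X_pow] using this.mul (hroot.pow (n - 1)))
  obtain ⟨p, rfl⟩ := Ideal.Quotient.mk_surjective s
  refine ⟨p, ?_⟩
  have h : q ∣ p ^ n - X := by
    rw [← hmk]
    simpa using hs
  have := aeval_eq_zero_of_dvd_aeval_eq_zero h (minpoly.aeval k θ)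
  simpa [sub_eq_zero] using this

end Root

/-! ### Semilinear maps of finite order -/

section LinearEquiv

variable {k : Type*} [Semiring k] {G : Type*} [Group G] {A : Type*} [Ring A]
  [MulSemiringAction G A] {X : Type*} [AddCommGroup X] [Module A X] [Module k X]

theorem IsSemilinearOver.pow {g : G} {φ : X ≃ₗ[k] X} (hφ : IsSemilinearOver A g φ) (i : ℕ) :
    IsSemilinearOver A (g ^ i) (φ ^ i : X ≃ₗ[k] X) := by
  induction i with
  | zero => intro a x; simp
  | succ i ih =>
    intro a x
    rw [pow_succ, pow_succ, LinearEquiv.mul_apply, LinearEquiv.mul_apply, hφ, ih, mul_smul]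

theorem IsSemilinearOver.symm {g : G} {φ : X ≃ₗ[k] X} (hφ : IsSemilinearOver A g φ) :
    IsSemilinearOver A g⁻¹ φ.symm := fun a x => by
  apply φ.injective
  rw [hφ, φ.apply_symm_apply, φ.apply_symm_apply, smul_inv_smul]

end LinearEquiv

section KLinear

variable {k : Type*} [Field k] {G : Type*} [Group G] {A : Type*} [Ring A] [MulSemiringAction G A]
  [Algebra k A] [SMulCommClass G k A]
  {X : Type*} [AddCommGroup X] [Module A X] [Module k X] [IsScalarTower k A X]

variable (k) in
/-- A semilinear bijection is `k`-linear, since the group acts `k`-linearly on `A`. -/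
def IsSemilinearOver.toLinearEquiv {g : G} {φ : X ≃+ X} (hφ : IsSemilinearOver A g φ) :
    X ≃ₗ[k] X :=
  { φ with
    map_smul' := fun c x => by
      have := hφ (algebraMap k A c) x
      rwa [smul_algebraMap, algebraMap_smul, algebraMap_smul] at this }

variable (k) in
theorem IsEquivariant.exists_linearEquiv {g : G} (h : IsEquivariant A g X) :
    ∃ φ : X ≃ₗ[k] X, IsSemilinearOver A g φ := by
  obtain ⟨φ, hφ⟩ := isEquivariant_iff_exists_addEquiv.1 h
  exact ⟨hφ.toLinearEquiv k, hφ⟩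

open Polynomial in
/-- If `φ : ^σX ≅ X` and `σ ^ n = 1`, then `φ ^ n` is an automorphism of `X`; dividing `φ` by an
`n`-th root of it that is a polynomial in `φ ^ n` gives an isomorphism with `n`-th power `1`. -/
theorem IsEquivariant.exists_pow_eq_one [IsAlgClosed k] [Module.Finite k X] {g : G} {n : ℕ}
    (hn : (n : k) ≠ 0) (hg : g ^ n = 1) (h : IsEquivariant A g X) :
    ∃ φ : X ≃ₗ[k] X, IsSemilinearOver A g φ ∧ φ ^ n = 1 := by
  have hn0 : n ≠ 0 := fun h => hn (by rw [h, Nat.cast_zero])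
  obtain ⟨φ, hφ⟩ := h.exists_linearEquiv k
  let toEnd := LinearEquiv.automorphismGroup.toLinearMapMonoidHom (R := k) (M := X)
  have hinj : Function.Injective toEnd := LinearEquiv.toLinearMap_injective
  let θ : Module.End k X := toEnd (φ ^ n)⁻¹
  obtain ⟨p, hp⟩ := exists_aeval_pow_eq ((Group.isUnit (φ ^ n)⁻¹).map toEnd) hn
  have hcomm {f : Module.End k X} (hf : Commute f θ) : Commute f (aeval θ p) := by
    have h : Algebra.adjoin k {θ} ≤ Subalgebra.centralizer k {f} :=
      Algebra.adjoin_le (Set.singleton_subset_iff.2 <|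
        (Subalgebra.mem_centralizer_iff k).2 fun _ hg => Set.mem_singleton_iff.1 hg ▸ hf)
    exact (Subalgebra.mem_centralizer_iff k).1 (h (aeval_mem_adjoin_singleton k θ)) f rfl
  have hsmul (a : A) (x : X) : aeval θ p (a • x) = a • aeval θ p x := by
    have h : Commute (Algebra.lsmul k k X a) θ := LinearMap.ext fun x => by
      have := (hφ.pow n).symm a x
      rw [hg, inv_one, one_smul] at this
      exact this.symm
    exact (LinearMap.congr_fun (hcomm h) x).symm
  have hpow : (toEnd φ * aeval θ p) ^ n = 1 := by
    have h : Commute (toEnd φ) θ := (((Commute.refl φ).pow_right n).inv_right).map toEnd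
    rw [(hcomm h).mul_pow, hp, ← map_pow, ← map_mul, mul_inv_cancel, map_one]
  let ψ : X ≃ₗ[k] X := .ofLinearMap (toEnd φ * aeval θ p) ((toEnd φ * aeval θ p) ^ (n - 1))
    ((mul_pow_sub_one hn0 _).trans hpow) ((pow_sub_one_mul hn0 _).trans hpow)
  refine ⟨ψ, fun a x => ?_, hinj ?_⟩
  · exact (congrArg φ (hsmul a x)).trans (hφ _ _)
  · rw [map_pow, map_one]
    exact hpow

end KLinear

/-! ### Averaging over the cyclic group -/

section Conj

variable {k : Type*} [Field k] {G : Type*} [Group G] {A : Type*} [Ring A] [MulSemiringAction G A]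
  [Algebra k A] {X : Type*} [AddCommGroup X] [Module A X] [Module k X]
  {U : Type*} [AddCommGroup U] [Module A U] [Module k U] [IsScalarTower k A U]

/-- The conjugation `f ↦ ψ ∘ f ∘ φ⁻¹` on the `A`-linear maps `X → U`, for `φ` and `ψ` semilinear
over the same `g`. -/
def conj {g : G} {φ : X ≃ₗ[k] X} (hφ : IsSemilinearOver A g φ) {ψ : U ≃ₗ[k] U}
    (hψ : IsSemilinearOver A g ψ) : Module.End k (X →ₗ[A] U) where
  toFun f :=
    { toFun := fun x => ψ (f (φ.symm x))
      map_add' := fun x y => by simp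
      map_smul' := fun a x => by
        rw [hφ.symm, map_smul, hψ, smul_inv_smul, RingHom.id_apply] }
  map_add' f f' := by ext; simp
  map_smul' c f := by ext; simp

theorem conj_apply {g : G} {φ : X ≃ₗ[k] X} (hφ : IsSemilinearOver A g φ) {ψ : U ≃ₗ[k] U}
    (hψ : IsSemilinearOver A g ψ) (f : X →ₗ[A] U) (x : X) : conj hφ hψ f x = ψ (f (φ.symm x)) := rfl

theorem conj_pow_apply {g : G} {φ : X ≃ₗ[k] X} (hφ : IsSemilinearOver A g φ) {ψ : U ≃ₗ[k] U}
    (hψ : IsSemilinearOver A g ψ) (i : ℕ) (f : X →ₗ[A] U) (x : X) :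
    (conj hφ hψ ^ i) f ((φ ^ i) x) = (ψ ^ i) (f x) := by
  induction i with
  | zero => rfl
  | succ i ih =>
    rw [pow_succ', pow_succ', pow_succ', Module.End.mul_apply, LinearEquiv.mul_apply,
      LinearEquiv.mul_apply, conj_apply, φ.symm_apply_apply, ih]

theorem conj_pow_eq_one {g : G} {φ : X ≃ₗ[k] X} (hφ : IsSemilinearOver A g φ) {ψ : U ≃ₗ[k] U}
    (hψ : IsSemilinearOver A g ψ) {n : ℕ} (hn : φ ^ n = 1) (hn' : ψ ^ n = 1) :
    conj hφ hψ ^ n = 1 := by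
  refine LinearMap.ext fun f => LinearMap.ext fun x => ?_
  have := conj_pow_apply hφ hψ n f x
  rwa [hn, hn'] at this

end Conj

section Averaging

variable {k : Type*} [Field k] {G : Type*} [Group G] {A : Type*} [Ring A] [MulSemiringAction G A]
  [Algebra k A]
  {X : Type*} [AddCommGroup X] [Module A X] [Module k X] [IsScalarTower k A X]
  {U : Type*} [AddCommGroup U] [Module A U] [Module k U] [IsScalarTower k A U]

variable {g : G} {φ : X ≃ₗ[k] X} (hφ : IsSemilinearOver A g φ) {ψ : U ≃ₗ[k] U}
    (hψ : IsSemilinearOver A g ψ)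

theorem conj_pow_comp (i : ℕ) (f : X →ₗ[A] U) (f' : U →ₗ[A] X) :
    (conj hψ hφ ^ i) f' ∘ₗ (conj hφ hψ ^ i) f = (conj hφ hφ ^ i) (f' ∘ₗ f) := by
  refine LinearMap.ext fun x => ?_
  obtain ⟨x, rfl⟩ := (φ ^ i).surjective x
  rw [LinearMap.comp_apply, conj_pow_apply, conj_pow_apply, conj_pow_apply, LinearMap.comp_apply]

/-- The sum over the powers of an operator `T` with `T ^ n = 1` has values fixed by `T`. -/
theorem apply_sum_pow_apply {H : Type*} [AddCommGroup H] [Module k H] {T : Module.End k H} {n : ℕ}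
    (hT : T ^ n = 1) (f : H) :
    T ((∑ i ∈ Finset.range n, T ^ i) f) = (∑ i ∈ Finset.range n, T ^ i) f := by
  have h : (T - 1) * ∑ i ∈ Finset.range n, T ^ i = 0 := by
    rw [mul_geom_sum, hT, sub_self]
  have := LinearMap.congr_fun h f
  rwa [Module.End.mul_apply, LinearMap.sub_apply, Module.End.one_apply, LinearMap.zero_apply,
    sub_eq_zero] at this

theorem IsPrimitiveRoot.sum_pow_mul_pow {ω : k} {n : ℕ} (hω : IsPrimitiveRoot ω n) {i j : ℕ}
    (hi : i < n) (hj : j < n) :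
    ∑ t ∈ Finset.range n, (ω⁻¹ ^ t) ^ i * (ω ^ t) ^ j = if i = j then (n : k) else 0 := by
  have hω0 : ω ≠ 0 := hω.ne_zero (by omega)
  have h (t : ℕ) : (ω⁻¹ ^ t) ^ i * (ω ^ t) ^ j = (ω⁻¹ ^ i * ω ^ j) ^ t := by
    rw [mul_pow, pow_right_comm, pow_right_comm ω]
  simp_rw [h]
  split_ifs with hij
  · simp [hij, inv_mul_cancel₀ (pow_ne_zero j hω0)]
  · have h1 : (ω⁻¹ ^ i * ω ^ j) ^ n = 1 := by
      rw [mul_pow, pow_right_comm, pow_right_comm ω, inv_pow, hω.pow_eq_one]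
      simp
    have h2 : ω⁻¹ ^ i * ω ^ j - 1 ≠ 0 := by
      rw [sub_ne_zero, inv_pow, Ne, inv_mul_eq_one₀ (pow_ne_zero _ hω0)]
      exact fun h => hij (hω.pow_inj hi hj h)
    have := mul_geom_sum (ω⁻¹ ^ i * ω ^ j) n
    rw [h1, sub_self] at this
    exact (mul_eq_zero.1 this).resolve_left h2

/-- Parseval's identity for the cyclic group of order `n`: the average of a product is the sum of
the products of the components of opposite weights. -/
theorem IsPrimitiveRoot.sum_bilin {H H' H'' : Type*} [AddCommGroup H] [Module k H]
    [AddCommGroup H'] [Module k H'] [AddCommGroup H''] [Module k H''] {ω : k} {n : ℕ}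
    (hω : IsPrimitiveRoot ω n) (B : H →ₗ[k] H' →ₗ[k] H'') (S : Module.End k H)
    (T : Module.End k H') (x : H) (y : H') :
    ∑ t ∈ Finset.range n, B ((∑ i ∈ Finset.range n, (ω⁻¹ ^ t • S) ^ i) x)
      ((∑ i ∈ Finset.range n, (ω ^ t • T) ^ i) y) =
    (n : k) • ∑ i ∈ Finset.range n, B ((S ^ i) x) ((T ^ i) y) := by
  simp only [smul_pow, LinearMap.sum_apply, map_sum, LinearMap.smul_apply, map_smul,
    Finset.smul_sum, smul_smul]
  rw [Finset.sum_comm]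
  refine Finset.sum_congr rfl fun j hj => ?_
  rw [Finset.sum_comm]
  simp_rw [← Finset.sum_smul, mul_comm ((ω ^ _) ^ j)]
  rw [Finset.sum_eq_single_of_mem j hj, hω.sum_pow_mul_pow, if_pos rfl]
  · exact Finset.mem_range.1 hj
  · exact Finset.mem_range.1 hj
  · intro i hi hij
    rw [hω.sum_pow_mul_pow (Finset.mem_range.1 hi) (Finset.mem_range.1 hj), if_neg hij, zero_smul]

/-- Summing the conjugates of an endomorphism of `X` by the powers of `φ` makes it commute
with `φ`. -/
def sumConj {n : ℕ} (hn : φ ^ n = 1) :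
    Module.End A X →+ commutant A φ.toLinearMap.toAddMonoidHom where
  toFun f := ⟨(∑ i ∈ Finset.range n, conj hφ hφ ^ i) f, fun x => by
    have h := LinearMap.congr_fun (apply_sum_pow_apply (conj_pow_eq_one hφ hφ hn hn) f) (φ x)
    rw [conj_apply, φ.symm_apply_apply] at h
    exact h.symm⟩
  map_zero' := Subtype.ext (map_zero _)
  map_add' f f' := Subtype.ext (map_add _ f f')

theorem sumConj_one {n : ℕ} (hn : φ ^ n = 1) : sumConj hφ hn 1 = n := by
  have h (i : ℕ) : (conj hφ hφ ^ i) (1 : Module.End A X) = 1 := by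
    refine LinearMap.ext fun x => ?_
    obtain ⟨x, rfl⟩ := (φ ^ i).surjective x
    exact conj_pow_apply hφ hφ i 1 x
  refine Subtype.ext ?_
  change (∑ i ∈ Finset.range n, conj hφ hφ ^ i) (1 : Module.End A X) = _
  simp [LinearMap.sum_apply, h]

theorem isUnit_natCast_commutant {n : ℕ} (hn : (n : k) ≠ 0) (φ : X →+ X) :
    IsUnit (n : commutant A φ) := by
  refine commutant_isUnit_of_isUnit ?_
  have := (IsUnit.mk0 _ hn).map (algebraMap k (Module.End A X))
  rwa [map_natCast] at this

/-- If the average over `⟨φ⟩` of a composite `X → U → X` is invertible and the endomorphisms of `X`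
commuting with `φ` form a local ring, then some weight component `X → U` is already a split
injection. It commutes with the actions of `φ` and of `ψ` up to a scalar. -/
theorem exists_semiinvariant_bijective [IsAlgClosed k] {ψ : U ≃ₗ[k] U}
    (hψ : IsSemilinearOver A g ψ) {n : ℕ} (hnk : (n : k) ≠ 0) (hn : φ ^ n = 1)
    (hn' : ψ ^ n = 1) [IsLocalRing (commutant A φ.toLinearMap.toAddMonoidHom)] (f : X →ₗ[A] U)
    (f' : U →ₗ[A] X) (hu : IsUnit (sumConj hφ hn (f' ∘ₗ f))) :
    ∃ (c : k) (i : X →ₗ[A] U) (p : U →ₗ[A] X), c ≠ 0 ∧ (∀ x, i (φ x) = c • ψ (i x)) ∧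
      (∀ u, φ (p u) = c • p (ψ u)) ∧ Function.Bijective (p ∘ₗ i) := by
  have : NeZero (n : k) := ⟨hnk⟩
  obtain ⟨ω, hω⟩ := HasEnoughRootsOfUnity.exists_primitiveRoot k n
  have hω0 : ω ≠ 0 := hω.ne_zero (fun h => hnk (by rw [h, Nat.cast_zero]))
  -- the weight components of `f` and `f'` (times `n`), for opposite weights
  let F (t : ℕ) : X →ₗ[A] U := (∑ j ∈ Finset.range n, (ω ^ t • conj hφ hψ) ^ j) f
  let F' (t : ℕ) : U →ₗ[A] X := (∑ j ∈ Finset.range n, (ω⁻¹ ^ t • conj hψ hφ) ^ j) f'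
  have hF (t : ℕ) (x : X) : F t (φ x) = ω ^ t • ψ (F t x) := by
    have h1 : (ω ^ t • conj hφ hψ) ^ n = 1 := by
      rw [smul_pow, conj_pow_eq_one hφ hψ hn hn', pow_right_comm, hω.pow_eq_one, one_pow, one_smul]
    have h := LinearMap.congr_fun (apply_sum_pow_apply h1 f) (φ x)
    rw [LinearMap.smul_apply, LinearMap.smul_apply, conj_apply, φ.symm_apply_apply] at h
    exact h.symm
  have hF' (t : ℕ) (u : U) : φ (F' t u) = ω ^ t • F' t (ψ u) := by
    have h1 : (ω⁻¹ ^ t • conj hψ hφ) ^ n = 1 := by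
      rw [smul_pow, conj_pow_eq_one hψ hφ hn' hn, pow_right_comm, inv_pow, hω.pow_eq_one, inv_one,
        one_pow, one_smul]
    have h := LinearMap.congr_fun (apply_sum_pow_apply h1 f') (ψ u)
    rw [LinearMap.smul_apply, LinearMap.smul_apply, conj_apply, ψ.symm_apply_apply, inv_pow,
      inv_smul_eq_iff₀ (pow_ne_zero _ hω0)] at h
    simpa only [F', inv_pow] using h
  have hcomm (t : ℕ) (x : X) : (F' t ∘ₗ F t) (φ x) = φ ((F' t ∘ₗ F t) x) := by
    rw [LinearMap.comp_apply, LinearMap.comp_apply, hF, hF', LinearMap.map_smul_of_tower]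
  have hsum : ∑ t ∈ Finset.range n, (⟨F' t ∘ₗ F t, hcomm t⟩ :
      commutant A φ.toLinearMap.toAddMonoidHom) = n * sumConj hφ hn (f' ∘ₗ f) := by
    have h := hω.sum_bilin (LinearMap.mk₂ k (fun (p : U →ₗ[A] X) (i : X →ₗ[A] U) => p ∘ₗ i)
      (fun _ _ _ => LinearMap.add_comp _ _ _) (fun _ _ _ => rfl)
      (fun _ _ _ => LinearMap.comp_add _ _ _) (fun c p i => by
        ext x; exact LinearMap.map_smul_of_tower p c (i x))) (conj hψ hφ) (conj hφ hψ) f' f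
    simp only [LinearMap.mk₂_apply, conj_pow_comp] at h
    refine Subtype.ext ?_
    rw [AddSubmonoidClass.coe_finsetSum]
    refine h.trans ?_
    rw [Nat.cast_smul_eq_nsmul, ← LinearMap.sum_apply, nsmul_eq_mul]
    rfl
  obtain ⟨t, -, ht⟩ := IsLocalRing.exists_of_isUnit_sum
    (hsum ▸ (isUnit_natCast_commutant hnk _).mul hu)
  exact ⟨ω ^ t, F t, F' t, pow_ne_zero t hω0, hF t, hF' t,
    (Module.End.isUnit_iff _).1 (ht.map (commutant A _).subtype)⟩

end Averaging

/-! ### Orbit sums -/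

section Orbit

variable {G : Type*} [Group G] {A : Type*} [Ring A] [MulSemiringAction G A] {σ : G}

/-- `Y ⊕ ^σY ⊕ ⋯ ⊕ ^{σ^m}Y` is `⟨σ⟩`-equivalent if `^{σ^(m+1)}Y ≅ Y`: shift the summands
cyclically. -/
theorem isEquivariant_pi_twist {Y : Type*} [AddCommGroup Y] [Module A Y] {m : ℕ}
    (h : IsEquivariant A (σ ^ (m + 1)) Y) :
    IsEquivariant A σ ((i : Fin (m + 1)) → Twist (σ ^ (i : ℕ)) Y) := by
  obtain ⟨ψ, hψ⟩ := isEquivariant_iff_exists_addEquiv.1 h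
  let F : (Fin (m + 1) → Y) ≃+ (Fin (m + 1) → Y) :=
    { toFun := fun y => Fin.cons (ψ (y (Fin.last m))) fun i => y i.castSucc
      invFun := fun z => Fin.snoc (fun i => z i.succ) (ψ.symm (z 0))
      left_inv := fun y => funext fun i => by
        cases i using Fin.lastCases <;> simp
      right_inv := fun z => funext fun i => by
        cases i using Fin.cases <;> simp
      map_add' := fun y z => funext fun i => by
        cases i using Fin.cases <;> simp }
  refine isEquivariant_iff_exists_addEquiv.2 ⟨F, fun a y => funext fun i => ?_⟩
  cases i using Fin.cases with
  | zero =>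
    refine (hψ ((σ ^ m)⁻¹ • a) (y (Fin.last m))).trans ?_
    refine congrArg (fun b : A => b • (ψ (y (Fin.last m)) : Y)) ?_
    change _ = (σ ^ 0)⁻¹ • σ • a
    rw [pow_zero, inv_one, one_smul, smul_smul, pow_succ', mul_inv_cancel_right]
  | succ i =>
    let z : Y := y i.castSucc
    change ((σ ^ (i : ℕ))⁻¹ • a) • z = ((σ ^ (i + 1 : ℕ))⁻¹ • σ • a) • z
    rw [smul_smul (_⁻¹), pow_succ', mul_inv_rev, inv_mul_cancel_right]

theorem IsOrbitSum.congr {X U : Type w} [AddCommGroup X] [Module A X] [AddCommGroup U]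
    [Module A U] (e : X ≃ₗ[A] U) (h : IsOrbitSum A σ X) : IsOrbitSum A σ U := by
  obtain ⟨Y, i₁, i₂, m, h₁, h₂, h₃, h₄, h₅, ⟨f⟩⟩ := h
  exact ⟨Y, i₁, i₂, m, h₁, h₂, h₃, h₄, h₅, ⟨e.symm.trans f⟩⟩

/-- If `Y` is a summand of an equivalent module `U`, so are its twists, which are pairwise
non-isomorphic up to the period `m`; hence their direct sum is a summand of `U`. -/
theorem IsDirectSummand.pi_twist {Y : Type*} [AddCommGroup Y] [Module A Y]
    [IsLocalRing (Module.End A Y)] {m : ℕ}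
    (hmin : ∀ j : ℕ, 1 ≤ j → j < m → ¬ IsEquivariant A (σ ^ j) Y) {U : Type*} [AddCommGroup U]
    [Module A U] (hU : IsEquivariant A σ U) (h : IsDirectSummand A Y U) :
    IsDirectSummand A ((i : Fin m) → Twist (σ ^ (i : ℕ)) Y) U := by
  have hne (i j : Fin m) (hij : (i : ℕ) < j) :
      IsEmpty (Twist (σ ^ (i : ℕ)) Y ≃ₗ[A] Twist (σ ^ (j : ℕ)) Y) :=
    ⟨fun e => hmin _ (by omega) (by omega) (.of_twist_equiv_twist hij.le e)⟩
  refine isDirectSummand_pi _ (fun i => .of_ringEquiv (Twist.endEquiv (A := A) (σ ^ (i : ℕ)) Y)) (fun i j hij => ?_) U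
    fun i => h.twist (hU.pow i)
  rcases lt_or_gt_of_ne (Fin.val_ne_of_ne hij) with hlt | hlt
  · exact hne i j hlt
  · exact ⟨fun e => (hne j i hlt).false e.symm⟩

/-- The easy half of the classification: by the exchange property, one of two equivalent
complementary summands of an orbit sum contains a copy of the whole orbit sum. -/
theorem IsOrbitSum.isIndecomposableEquivariant {X : Type w} [AddCommGroup X] [Module A X]
    [IsArtinianRing A] [IsArtinian A X] (h : IsOrbitSum A σ X) :
    IsIndecomposableEquivariant A σ X := by
  obtain ⟨Y, _, _, m, hfin, hY, hm, hYm, hmin, ⟨e⟩⟩ := h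
  obtain ⟨m, rfl⟩ : ∃ m', m = m' + 1 := ⟨m - 1, by omega⟩
  have := hY.1
  have := hY.isLocalRing_end
  let e₀ : Twist (σ ^ 0) Y ≃ₗ[A] Y := Twist.equivOfSemilinear (AddEquiv.refl Y) fun a y => by simp
  have hsum : IsDirectSummand A Y X := by
    have h1 : IsDirectSummand A (Twist (σ ^ ((0 : Fin (m + 1)) : ℕ)) Y)
        ((i : Fin (m + 1)) → Twist (σ ^ (i : ℕ)) Y) :=
      ⟨LinearMap.single A (fun i : Fin (m + 1) => Twist (σ ^ (i : ℕ)) Y) 0, LinearMap.proj 0, LinearMap.proj_comp_single_same A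
        (fun i : Fin (m + 1) => Twist (σ ^ (i : ℕ)) Y) 0⟩
    exact (e₀.symm.isDirectSummand.trans h1).trans e.symm.isDirectSummand
  have htop {U W : Submodule A X} (hUW : IsCompl U W) (hU : IsEquivariant A σ U)
      (hYU : IsDirectSummand A Y U) : W = ⊥ := by
    obtain ⟨i, p, hip⟩ := hYU.pi_twist hmin hU
    have hi : Function.Injective (i ∘ₗ e.toLinearMap) :=
      (LinearMap.injective_of_comp_eq_id i p hip).comp e.injective
    have := Submodule.eq_top_of_injective _ hi
    exact eq_bot_of_top_isCompl (this ▸ hUW)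
  refine ⟨?_, (isEquivariant_pi_twist hYm).congr e.symm, fun U W hUW hU hW => ?_⟩
  · obtain ⟨i, p, hip⟩ := hsum
    exact (LinearMap.injective_of_comp_eq_id i p hip).nontrivial
  · rcases hsum.of_isCompl hUW with h | h
    · exact Or.inr (htop hUW hU h)
    · exact Or.inl (htop hUW.symm hW h)

end Orbit

section FiniteDimensional

variable {k : Type*} [Field k] [IsAlgClosed k] {G : Type*} [Group G] {A : Type*} [Ring A]
  [MulSemiringAction G A] [Algebra k A] [SMulCommClass G k A] 
  {X : Type w} [AddCommGroup X] [Module A X] [Module k X] [IsScalarTower k A X]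
  [Module.Finite k X] {σ : G} {n : ℕ}

/-- Writing `n` as a sum of the averages of the projections onto two complementary equivalent
submodules `U` and `W`, one of them is invertible, so that `X` embeds into `U` or into `W`. -/
theorem IsIndecomposableUnder.isIndecomposableEquivariant (hnk : (n : k) ≠ 0) (hσ : σ ^ n = 1)
    [Nontrivial X] {φ : X ≃ₗ[k] X} (hφ : IsSemilinearOver A σ φ) (hn : φ ^ n = 1)
    (h : IsIndecomposableUnder A φ.toLinearMap.toAddMonoidHom) :
    IsIndecomposableEquivariant A σ X := by
  have : IsArtinian A X := isArtinian_of_tower k inferInstance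
  have : IsNoetherian A X := isNoetherian_of_tower k inferInstance
  have := h.isLocalRing_commutant
  refine ⟨inferInstance, isEquivariant_iff_exists_addEquiv.2 ⟨φ.toAddEquiv, hφ⟩,
    fun U W hUW hU hW => ?_⟩
  have hbot {U W : Submodule A X} (hUW : IsCompl U W) (hU : IsEquivariant A σ U)
      (hu : IsUnit (sumConj hφ hn (U.subtype ∘ₗ U.projectionOnto W hUW))) : W = ⊥ := by
    have : Module.Finite k U :=
      Module.Finite.of_injective (U.subtype.restrictScalars k) U.injective_subtype
    obtain ⟨ψ, hψ, hn'⟩ := hU.exists_pow_eq_one hnk hσ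
    obtain ⟨c, i, p, -, -, -, hpi⟩ := exists_semiinvariant_bijective hφ hψ hnk hn hn' _ _ hu
    have := Submodule.eq_top_of_injective i (hpi.1.of_comp (f := p))
    exact eq_bot_of_top_isCompl (this ▸ hUW)
  have hsum : sumConj hφ hn (U.subtype ∘ₗ U.projectionOnto W hUW) +
      sumConj hφ hn (W.subtype ∘ₗ W.projectionOnto U hUW.symm) = n := by
    rw [← map_add, ← sumConj_one hφ hn]
    exact congrArg _ (LinearMap.ext (Submodule.projection_add_projection_eq_self hUW))
  rcases IsLocalRing.isUnit_or_isUnit_of_isUnit_add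
    (hsum ▸ isUnit_natCast_commutant hnk _) with hu | hu
  · exact Or.inr (hbot hUW hU hu)
  · exact Or.inl (hbot hUW.symm hW hu)

/-- An equivalent direct summand of an indecomposable equivalent module `X` that is itself
indecomposable equivalent is isomorphic to `X`: averaging turns the splitting into one that is
compatible with the semilinear maps of finite order up to scalars. -/
theorem IsIndecomposableEquivariant.nonempty_linearEquiv (hnk : (n : k) ≠ 0) (hσ : σ ^ n = 1)
    (hX : IsIndecomposableEquivariant A σ X) {U W : Submodule A X} (hUW : IsCompl U W)
    (hU : IsIndecomposableEquivariant A σ U) : Nonempty (U ≃ₗ[A] X) := by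
  have : Module.Finite k U :=
    Module.Finite.of_injective (U.subtype.restrictScalars k) U.injective_subtype
  have : IsArtinian A U := isArtinian_of_tower k inferInstance
  have : IsNoetherian A U := isNoetherian_of_tower k inferInstance
  obtain ⟨φ, hφ, hn⟩ := hX.2.1.exists_pow_eq_one hnk hσ
  obtain ⟨ψ, hψ, hn'⟩ := hU.2.1.exists_pow_eq_one hnk hσ
  have := hU.1
  have : IsLocalRing (commutant A ψ.toLinearMap.toAddMonoidHom) :=
    (hU.isIndecomposableUnder (φ := ψ.toAddEquiv) hψ).isLocalRing_commutant
  have hone : U.projectionOnto W hUW ∘ₗ U.subtype = (1 : Module.End A U) := by ext; simp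
  obtain ⟨c, i, p, hc, hi, hp, hpi⟩ := exists_semiinvariant_bijective hψ hφ hnk hn' hn
    U.subtype (U.projectionOnto W hUW) (by
      rw [hone, sumConj_one]; exact isUnit_natCast_commutant hnk _)
  have hcompl := LinearMap.isCompl_range_ker_of_bijective hpi
  have hrange : ∀ x ∈ LinearMap.range i, φ x ∈ LinearMap.range i := by
    rintro _ ⟨y, rfl⟩
    refine ⟨c⁻¹ • ψ y, ?_⟩
    rw [LinearMap.map_smul_of_tower, hi, inv_smul_smul₀ hc]
  have hker : ∀ x ∈ LinearMap.ker p, φ x ∈ LinearMap.ker p := by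
    intro x hx
    rw [LinearMap.mem_ker] at hx ⊢
    have := hp x
    rw [hx, map_zero] at this
    exact (smul_eq_zero.1 this.symm).resolve_left hc
  rcases hX.isIndecomposableUnder (φ := φ.toAddEquiv) hφ _ _ hcompl hrange hker with h | h
  · obtain ⟨y, hy⟩ := exists_ne (0 : U)
    refine absurd (hpi.1 ?_) hy
    simp [LinearMap.range_eq_bot.1 h]
  · have hsurj : Function.Surjective p := Function.Surjective.of_comp (g := i) hpi.2
    exact ⟨(LinearEquiv.ofBijective p ⟨LinearMap.ker_eq_bot.1 h, hsurj⟩).symm⟩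

/-- The other half of the classification: an indecomposable equivalent module `X` contains the
orbit sum of each of its indecomposable summands as a direct summand, hence is equal to it. -/
theorem IsIndecomposableEquivariant.isOrbitSum [Module.Finite k A] (hnk : (n : k) ≠ 0) (hσ : σ ^ n = 1)
    (hX : IsIndecomposableEquivariant A σ X) : IsOrbitSum A σ X := by
  classical
  have : IsArtinian A X := isArtinian_of_tower k inferInstance
  have : IsNoetherian A X := isNoetherian_of_tower k inferInstance
  have : IsArtinianRing A := isArtinian_of_tower k inferInstance
  have := hX.1
  obtain ⟨Y, hY, hYX⟩ := exists_indecomposable_isDirectSummand (R := A) (X := X)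
  have := hY.isLocalRing_end
  have hex : ∃ m : ℕ, 1 ≤ m ∧ IsEquivariant A (σ ^ m) Y :=
    ⟨n, Nat.pos_of_ne_zero fun h => hnk (by rw [h, Nat.cast_zero]), by
      rw [hσ]; exact IsEquivariant.one⟩
  have hmin (j : ℕ) (h1 : 1 ≤ j) (hj : j < Nat.find hex) : ¬ IsEquivariant A (σ ^ j) Y :=
    fun h => Nat.find_min hex hj ⟨h1, h⟩
  obtain ⟨i, p, hip⟩ := hYX.pi_twist hmin hX.2.1
  have hinj : Function.Injective i := LinearMap.injective_of_comp_eq_id i p hip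
  have hU : IsOrbitSum A σ (LinearMap.range i) :=
    ⟨Y, inferInstance, inferInstance, Nat.find hex, inferInstance, hY, (Nat.find_spec hex).1,
      (Nat.find_spec hex).2, hmin, ⟨(LinearEquiv.ofInjective i hinj).symm⟩⟩
  have hcompl : IsCompl (LinearMap.range i) (LinearMap.ker p) :=
    LinearMap.isCompl_range_ker_of_bijective (hip ▸ Function.bijective_id)
  exact hU.congr (hX.nonempty_linearEquiv hnk hσ hcompl hU.isIndecomposableEquivariant).some

end FiniteDimensional

/-! ### Modules over the skew group algebra -/

section Skew

variable {G : Type*} [Group G] {A : Type*} [Ring A] [MulSemiringAction G A] {σ : G}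

theorem isCompl_iff_forall {R M : Type*} [Ring R] [AddCommGroup M] [Module R M]
    {Y Z : Submodule R M} :
    IsCompl Y Z ↔ (∀ x ∈ Y, x ∈ Z → x = 0) ∧ ∀ x, ∃ y ∈ Y, ∃ z ∈ Z, y + z = x := by
  rw [isCompl_iff, Submodule.disjoint_def, codisjoint_iff, Submodule.eq_top_iff']
  simp_rw [Submodule.mem_sup]

variable {X : Type*} [AddCommGroup X] [Module (SkewCyclicAlgebra A σ) X]

open SkewMonoidAlgebra in
/-- The action of the generator `1 # σ` on a module over the skew group algebra. -/
def generatorEquiv (A : Type*) [Ring A] [MulSemiringAction G A] (σ : G) (X : Type*)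
    [AddCommGroup X] [Module (SkewCyclicAlgebra A σ) X] : X ≃+ X :=
  let s : Subgroup.zpowers σ := ⟨σ, Subgroup.mem_zpowers σ⟩
  { toFun := fun x => (single s 1 : SkewCyclicAlgebra A σ) • x
    invFun := fun x => (single s⁻¹ 1 : SkewCyclicAlgebra A σ) • x
    left_inv := fun x => by
      beta_reduce
      rw [smul_smul, single_mul_single, inv_mul_cancel, smul_one, mul_one, single_one_one, one_smul]
    right_inv := fun x => by
      beta_reduce
      rw [smul_smul, single_mul_single, mul_inv_cancel, smul_one, mul_one, single_one_one, one_smul]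
    map_add' := fun x y => smul_add _ x y }

theorem single_pow_generator_smul (i : ℕ) (x : X) :
    (SkewMonoidAlgebra.single ((⟨σ, Subgroup.mem_zpowers σ⟩ : Subgroup.zpowers σ) ^ i) 1 :
      SkewCyclicAlgebra A σ) • x = (generatorEquiv A σ X)^[i] x := by
  induction i with
  | zero => rw [pow_zero, SkewMonoidAlgebra.single_one_one, one_smul]; rfl
  | succ i ih =>
    rw [Function.iterate_succ_apply', ← ih, pow_succ']
    simp only [generatorEquiv, AddEquiv.coe_mk, Equiv.coe_fn_mk]
    rw [smul_smul, SkewMonoidAlgebra.single_mul_single, smul_one, mul_one]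

variable [Module A X] [IsScalarTower A (SkewCyclicAlgebra A σ) X]

theorem single_smul_eq (g : Subgroup.zpowers σ) (a : A) (x : X) :
    (SkewMonoidAlgebra.single g a : SkewCyclicAlgebra A σ) • x =
      a • (SkewMonoidAlgebra.single g 1 : SkewCyclicAlgebra A σ) • x := by
  rw [← smul_assoc, SkewMonoidAlgebra.smul_single, smul_eq_mul, mul_one]

theorem generatorEquiv_semilinear : IsSemilinearOver A σ (generatorEquiv A σ X) := fun a x => by
  have h : a • x = (SkewMonoidAlgebra.single 1 a : SkewCyclicAlgebra A σ) • x := by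
    rw [single_smul_eq, SkewMonoidAlgebra.single_one_one, one_smul]
  change (SkewMonoidAlgebra.single _ 1 : SkewCyclicAlgebra A σ) • a • x =
    (σ • a) • (SkewMonoidAlgebra.single _ 1 : SkewCyclicAlgebra A σ) • x
  rw [h, smul_smul, SkewMonoidAlgebra.single_mul_single, one_mul, mul_one, single_smul_eq]
  rfl

/-- The submodules over the skew group algebra are exactly the `A`-submodules stable under `1 # σ`,
as `σ` has finite order. -/
theorem IsIndecomposableModule.isIndecomposableUnder (hσ : IsOfFinOrder σ)
    (h : IsIndecomposableModule (SkewCyclicAlgebra A σ) X) :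
    IsIndecomposableUnder A (generatorEquiv A σ X : X →+ X) := by
  intro Y Z hYZ hY hZ
  let toSkew (Y : Submodule A X) (hY : ∀ y ∈ Y, generatorEquiv A σ X y ∈ Y) :
      Submodule (SkewCyclicAlgebra A σ) X :=
    { Y.toAddSubmonoid with
      smul_mem' := fun f y hy => by
        induction f using SkewMonoidAlgebra.induction_on with
        | zero => rw [zero_smul]; exact Y.zero_mem
        | add f f' hf hf' => rw [add_smul]; exact Y.add_mem hf hf'
        | single g a =>
          obtain ⟨g, hg⟩ := g
          obtain ⟨i, rfl⟩ := hσ.mem_powers_iff_mem_zpowers.2 hg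
          rw [single_smul_eq]
          refine Y.smul_mem a ?_
          have : (⟨σ ^ i, hg⟩ : Subgroup.zpowers σ) = ⟨σ, Subgroup.mem_zpowers σ⟩ ^ i := rfl
          rw [this, single_pow_generator_smul]
          exact Set.MapsTo.iterate (s := (Y : Set X)) hY i hy }
  have hc : IsCompl (toSkew Y hY) (toSkew Z hZ) := by
    have h' := isCompl_iff_forall.1 hYZ
    exact isCompl_iff_forall.2 ⟨h'.1, h'.2⟩
  refine (h.2 _ _ hc).imp (fun h => ?_) fun h => ?_
  · have h' := (Submodule.eq_bot_iff (toSkew Y hY)).1 h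
    exact (Submodule.eq_bot_iff Y).2 h'
  · have h' := (Submodule.eq_bot_iff (toSkew Z hZ)).1 h
    exact (Submodule.eq_bot_iff Z).2 h'

theorem finite_of_skew_finite (hσ : IsOfFinOrder σ) [Module.Finite (SkewCyclicAlgebra A σ) X] :
    Module.Finite A X := by
  have : Finite (Subgroup.zpowers σ) := finite_zpowers.2 hσ
  have : Module.Finite A (SkewCyclicAlgebra A σ) :=
    Module.Finite.of_basis SkewMonoidAlgebra.basisSingleOne
  exact Module.Finite.trans (SkewCyclicAlgebra A σ) X

end Skew

/-- Complementary submodules over the skew group algebra are stable under `φ`, hence equivalent. -/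
theorem IsIndecomposableEquivariant.isIndecomposableModule {G : Type*} [Group G] {A : Type*}
    [Ring A] [MulSemiringAction G A] {σ : G} {X : Type*} [AddCommGroup X] [Module A X]
    (h : IsIndecomposableEquivariant A σ X) (φ : Twist σ X ≃ₗ[A] X)
    (hφ : untwist φ ^ orderOf σ = 1) :
    letI : Module (SkewCyclicAlgebra A σ) X := canonicalInducedModule φ hφ
    IsIndecomposableModule (SkewCyclicAlgebra A σ) X := by
  let : Module (SkewCyclicAlgebra A σ) X := canonicalInducedModule φ hφ
  refine ⟨h.1, fun Y Z hYZ => ?_⟩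
  have hA (a : A) (x : X) : a • x = (SkewMonoidAlgebra.single 1 a : SkewCyclicAlgebra A σ) • x := by
    rw [canonicalInducedModule_single_smul, map_one]
    rfl
  have hstable (Y : Submodule (SkewCyclicAlgebra A σ) X) (y : X) (hy : y ∈ Y) :
      untwist φ y ∈ Y := by
    have := Y.smul_mem (SkewMonoidAlgebra.single ⟨σ, Subgroup.mem_zpowers σ⟩ 1) hy
    rwa [canonicalInducedModule_single_smul, one_smul, cyclicAction_gen] at this
  let restrict (Y : Submodule (SkewCyclicAlgebra A σ) X) : Submodule A X :=
    { Y.toAddSubmonoid with smul_mem' := fun a y hy => by rw [hA]; exact Y.smul_mem _ hy }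
  have hc : IsCompl (restrict Y) (restrict Z) := by
    have h' := isCompl_iff_forall.1 hYZ
    exact isCompl_iff_forall.2 ⟨h'.1, h'.2⟩
  refine (h.isIndecomposableUnder (φ := (untwist φ).toAddEquiv) (untwist_smul φ) _ _ hc
    (hstable Y) (hstable Z)).imp (fun h => ?_) fun h => ?_
  · have h' := (Submodule.eq_bot_iff (restrict Y)).1 h
    exact (Submodule.eq_bot_iff Y).2 h'
  · have h' := (Submodule.eq_bot_iff (restrict Z)).1 h
    exact (Submodule.eq_bot_iff Z).2 h'

/-- A module over a `k`-algebra carries the vector space structure that `k` induces on it. -/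
theorem isScalarTower_compHom {k A X : Type*} [CommRing k] [Ring A] [Algebra k A]
    [AddCommGroup X] [Module A X] :
    letI : Module k X := Module.compHom X (algebraMap k A)
    IsScalarTower k A X :=
  letI : Module k X := Module.compHom X (algebraMap k A)
  ⟨fun c a x => by rw [Algebra.smul_def, mul_smul]; rfl⟩

section Main

variable {k : Type*} [Field k] [IsAlgClosed k] {G : Type*} [Group G] {A : Type*} [Ring A]
  [MulSemiringAction G A] [Algebra k A] [SMulCommClass G k A] [Module.Finite k A] {σ : G}
  {X : Type w} [AddCommGroup X] [Module A X]

variable (k) in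
theorem isIndecomposableEquivariant_iff_isOrbitSum (hσ : ((orderOf σ : ℕ) : k) ≠ 0)
    [Module.Finite A X] : IsIndecomposableEquivariant A σ X ↔ IsOrbitSum A σ X := by
  let : Module k X := Module.compHom X (algebraMap k A)
  have : IsScalarTower k A X := isScalarTower_compHom
  have : Module.Finite k X := Module.Finite.trans A X
  have : IsArtinianRing A := isArtinian_of_tower k inferInstance
  exact ⟨fun h => h.isOrbitSum hσ (pow_orderOf_eq_one σ), fun h => h.isIndecomposableEquivariant⟩

variable (k) in
theorem isIndecomposableEquivariant_of_skew (hσ : ((orderOf σ : ℕ) : k) ≠ 0)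
    [Module (SkewCyclicAlgebra A σ) X] [IsScalarTower A (SkewCyclicAlgebra A σ) X]
    [Module.Finite A X] (h : IsIndecomposableModule (SkewCyclicAlgebra A σ) X) :
    IsIndecomposableEquivariant A σ X := by
  let : Module k X := Module.compHom X (algebraMap k A)
  have : IsScalarTower k A X := isScalarTower_compHom
  have : Module.Finite k X := Module.Finite.trans A X
  have hfin : IsOfFinOrder σ := orderOf_ne_zero_iff.1 fun h => hσ (by rw [h, Nat.cast_zero])
  have := h.1
  have hsemi : IsSemilinearOver A σ (generatorEquiv A σ X) := generatorEquiv_semilinear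
  let φ : X ≃ₗ[k] X := hsemi.toLinearEquiv k
  refine IsIndecomposableUnder.isIndecomposableEquivariant hσ (pow_orderOf_eq_one σ) (φ := φ)
    hsemi ?_ (h.isIndecomposableUnder hfin)
  refine LinearEquiv.ext fun x => ?_
  rw [LinearEquiv.pow_apply]
  refine (single_pow_generator_smul (A := A) (σ := σ) (orderOf σ) x).symm.trans ?_
  have h1 : (⟨σ, Subgroup.mem_zpowers σ⟩ : Subgroup.zpowers σ) ^ orderOf σ = 1 :=
    Subtype.ext (pow_orderOf_eq_one σ)
  rw [h1, SkewMonoidAlgebra.single_one_one, one_smul]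
  rfl

variable (k) in
theorem IsEquivariant.exists_untwist_pow_eq_one (hσ : ((orderOf σ : ℕ) : k) ≠ 0)
    [Module.Finite A X] (h : IsEquivariant A σ X) :
    ∃ φ : Twist σ X ≃ₗ[A] X, untwist φ ^ orderOf σ = 1 := by
  let : Module k X := Module.compHom X (algebraMap k A)
  have : IsScalarTower k A X := isScalarTower_compHom
  have : Module.Finite k X := Module.Finite.trans A X
  obtain ⟨φ, hφ, hn⟩ := h.exists_pow_eq_one hσ (pow_orderOf_eq_one σ)
  refine ⟨Twist.equivOfSemilinear φ.toAddEquiv hφ, LinearEquiv.ext fun x => ?_⟩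
  rw [LinearEquiv.pow_apply]
  have := LinearEquiv.congr_fun hn x
  rwa [LinearEquiv.pow_apply] at this

end Main

theorem theorem4p9
    {k : Type*} [Field k] [IsAlgClosed k]
    {V : Type*} [Quiver V] [Fintype V] [∀ a b : V, Finite (a ⟶ b)]
    (hconn : Quiver.IsStronglyConnected (Quiver.Symmetrify V))
    (hacyc : NoOrientedCycles V)
    (σ : QuiverAut V) (n : ℕ) (hn : orderOf σ = n) (hchar : ¬ ringChar k ∣ n) :
    -- the indecomposable `⟨σ⟩`-equivalent modules are the modules `Y ⊕ ^σY ⊕ ⋯ ⊕ ^{σ^{m-1}}Y`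
    (∀ (X : Type*) [AddCommGroup X] [Module (PathAlgebra k V) X] [Module.Finite (PathAlgebra k V) X],
      IsIndecomposableEquivariant (PathAlgebra k V) σ X ↔ IsOrbitSum (PathAlgebra k V) σ X) ∧
    -- an indecomposable `kQ # k⟨σ⟩`-module is, as a `kQ`-module (the scalar tower says that `kQ`
    -- acts through its inclusion), an indecomposable `⟨σ⟩`-equivalent module
    (∀ (X : Type*) [AddCommGroup X] [Module (SkewCyclicAlgebra (PathAlgebra k V) σ) X]
      [Module (PathAlgebra k V) X]
      [IsScalarTower (PathAlgebra k V) (SkewCyclicAlgebra (PathAlgebra k V) σ) X]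
      [Module.Finite (SkewCyclicAlgebra (PathAlgebra k V) σ) X],
      IsIndecomposableModule (SkewCyclicAlgebra (PathAlgebra k V) σ) X →
        IsIndecomposableEquivariant (PathAlgebra k V) σ X ∧ IsOrbitSum (PathAlgebra k V) σ X) ∧
    -- the canonical induced modules on an indecomposable `⟨σ⟩`-equivalent module exist and are
    -- indecomposable
    (∀ (X : Type*) [AddCommGroup X] [Module (PathAlgebra k V) X] [Module.Finite (PathAlgebra k V) X],
      IsIndecomposableEquivariant (PathAlgebra k V) σ X →
        (∃ φ : Twist σ X ≃ₗ[PathAlgebra k V] X, untwist φ ^ orderOf σ = 1) ∧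
        ∀ (φ : Twist σ X ≃ₗ[PathAlgebra k V] X) (hφ : untwist φ ^ orderOf σ = 1),
          letI : Module (SkewCyclicAlgebra (PathAlgebra k V) σ) X := canonicalInducedModule φ hφ
          IsIndecomposableModule (SkewCyclicAlgebra (PathAlgebra k V) σ) X) := by

  subst hn
  -- this includes that the order is nonzero, i.e. finite, since every characteristic divides `0`
  have hσ : ((orderOf σ : ℕ) : k) ≠ 0 := fun h => hchar ((ringChar.spec k _).1 h)
  have hfin : IsOfFinOrder σ := orderOf_ne_zero_iff.1 fun h => hσ (by rw [h, Nat.cast_zero])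
  have : Module.Finite k (PathAlgebra k V) := PathAlgebra.finite hacyc
  refine ⟨fun X _ _ _ => isIndecomposableEquivariant_iff_isOrbitSum k hσ, ?_, ?_⟩
  · intro X _ _ _ _ _ h
    have : Module.Finite (PathAlgebra k V) X := finite_of_skew_finite hfin
    have hX := isIndecomposableEquivariant_of_skew k hσ h
    exact ⟨hX, (isIndecomposableEquivariant_iff_isOrbitSum k hσ).1 hX⟩
  · exact fun X _ _ _ h => ⟨h.2.1.exists_untwist_pow_eq_one k hσ, h.isIndecomposableModule⟩

end
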